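/- **Setting.** For $l=1,2$ let $X_l\subset\mathbb{R}^{m_l}$ be nonempty, compact and convex, let $\|\cdot\|$ be a norm on $\mathbb{R}^{m_l}$ with dual norm $\|\cdot\|_*$, and let $O_l\supseteq X_l$ be open and convex. Network $l$ has $n_l\ge 1$ agents. Let $\xi$ be a random vector in $\mathbb{R}^d$. Agent $i$ of network 1 has the cost $f_{1,i}(x_1,x_2)=\mathbb{E}[\varphi_{1,i}(x_1,x_2;\xi)]$, which is defined on $O_1\times X_2$, convex in $x_1$ and concave in $x_2$; agent $j$ of network 2 has the cost $f_{2,j}(x_1,x_2)=\mathbb{E}[\varphi_{2,j}(x_1,x_2;\xi)]$, which is defined on $X_1\times O_2$, concave in $x_1$ and convex in $x_2$. Suppose that on $X_1\times X_2$ $$U=\frac1{n_1}\sum_{i}f_{1,i}=-\frac1{n_2}\sum_{j}f_{2,j},$$ and that, for some $\mu>0$, $U$ is $\mu$-strongly convex in $x_1\in X_1$ and $\mu$-strongly concave in $x_2\in X_2$. A Nash equilibrium (NE) is a point $(x_1^*,x_2^*)\in X_1\times X_2$ with $U(x_1^*,x_2)\le U(x_1^*,x_2^*)\le U(x_1,x_2^*)$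 for all $(x_1,x_2)\in X_1\times X_2$. **Networks.** Let $0<\eta<1$. For $l=1,2$ the digraphs $\mathcal{G}_l(t)$, $t\ge0$, on the agents of network $l$ contain all self-loops, and for some integer $B_l\ge1$ the union of any $B_l$ consecutive ones is strongly connected. The matrices $W_l(t)=[w_{l,ij}(t)]$ have all row and column sums equal to $1$, with $w_{l,ij}(t)\ge\eta$ if $(j,i)$ is an edge of $\mathcal{G}_l(t)$ and $w_{l,ij}(t)=0$ otherwise. Between the networks there are nonnegative weights $w_{12,ij}(t)$, where agent $i$ belongs to one network and $j$ runs over the agents of the other, positive only along the edges of a bipartite digraph, with $\sum_j w_{12,ij}(t)=1$ for every agent $i$. **Algorithm (D-SMD).** Let $\psi_l$ be differentiable at every point of $X_l$ and $1$-strongly convex on $X_l$, and let $D_{\psi_l}(x,p)=\psi_l(x)-\psi_l(p)-\langle\nabla\psi_l(p),x-p\rangle$. Assume that $R_l^2=\max\{D_{\psi_l}(x,x'):x,x'\in X_l\}$ exists. Let $\alpha(t)\ge0$ be non-increasing. Start from (possibly random) points $x_{l,i}(0)\in X_l$. At time $t$ agent $i$ of network $l$ forms $v_{l,i}(t)=\sum_j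 w_{l,ij}(t)x_{l,j}(t)$ and $u_{3-l,i}(t)=\sum_j w_{12,ij}(t)x_{3-l,j}(t)$. It then receives a sampled subgradient $\hat g_{l,i}(t)$ of $\varphi_{l,i}(\cdot\,;\xi_{l,i}(t))$ with respect to its own strategy in $O_l$, taken at $v_{l,i}(t)$ with the strategy of the other network fixed at $u_{3-l,i}(t)$, and sets $$x_{l,i}(t+1)=\operatorname*{arg\,min}_{x'\in X_l}\big\{\alpha(t)\langle\hat g_{l,i}(t),x'-v_{l,i}(t)\rangle+D_{\psi_l}(x',v_{l,i}(t))\big\}.$$ All the $\xi_{l,i}(t)$ are independent copies of $\xi$. Let $\mathcal{F}_t$ be the $\sigma$-algebra generated by the initial points and all the samples drawn before time $t$; $\hat g_{l,i}(t)$ is $\mathcal{F}_{t+1}$-measurable. **Assumptions.** (A1) There is $L>0$ such that $|f_{l,i}(x_1,x_2)-f_{l,i}(x_1',x_2')|\le L(\|x_1-x_1'\|+\|x_2-x_2'\|)$ on the domain of $f_{l,i}$, for all $l,i$. (A2) There are $\nu_1,\nu_2>0$ and, for all $l,i,t$, a subgradient $g_{l,i}(t)$ of $f_{l,i}$ with respect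 to the own strategy in $O_l$, at $v_{l,i}(t)$ with the other strategy fixed at $u_{3-l,i}(t)$, such that $\mathbb{E}[\hat g_{l,i}(t)\mid\mathcal{F}_t]=g_{l,i}(t)$ and $\mathbb{E}[\|g_{l,i}(t)-\hat g_{l,i}(t)\|_*^2\mid\mathcal{F}_t]\le\nu_l^2$. (A3) For $l=1,2$, $D_{\psi_l}(x,y)$ is convex in $y\in X_l$, and $x_k\to x$ in $X_l$ implies $D_{\psi_l}(x_k,x)\to0$. **Claim.** The game has exactly one NE $(x_1^*,x_2^*)$. Let $\hat x_{l,i}(t)=\sum_{s=0}^{t-1}\alpha(s)x_{l,i}(s)\big/\sum_{s=0}^{t-1}\alpha(s)$. Then for all agents $i$ of network 1 and $j$ of network 2 and all $t$ with $\sum_{s=0}^{t-1}\alpha(s)>0$, $$\mathbb{E}\big[\|\hat x_{1,i}(t)-x_1^*\|^2+\|\hat x_{2,j}(t)-x_2^*\|^2\big]\le\frac2\mu\cdot\frac{M_1+M_2\sum_{s=0}^{t-1}\alpha(s)^2}{\sum_{s=0}^{t-1}\alpha(s)},$$ where $$M_1=\sum_{l=1}^2\Big(\frac{4Ln_l\Gamma_l\Lambda_l\alpha(0)}{1-\theta_l}+2R_l^2\Big),\qquad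 M_2=\sum_{l=1}^2\Big(4L(L+\nu_l)\Big(\frac{n_l\Gamma_l}{1-\theta_l}+2\Big)+(L+\nu_l)^2+\frac{\nu_l^2}2\Big),$$ $\Gamma_l=(1-\eta/(4n_l^2))^{-2}$, $\theta_l=(1-\eta/(4n_l^2))^{1/B_l}$ and $\Lambda_l=\mathbb{E}[\max_i\|x_{l,i}(0)\|]$ (which is $\max_i\|x_{l,i}(0)\|$ for non-random initial points). In particular, if $\sum_{t}\alpha(t)=\infty$ and $\sum_t\alpha(t)^2<\infty$, then $(\hat x_{1,i}(t),\hat x_{2,j}(t))$ converges in mean square to the unique NE for all $i,j$. -/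

import Mathlib

open MeasureTheory ProbabilityTheory Filter Topology

namespace DSMD

/-- `(x₁, x₂)` is a Nash equilibrium of the zero-sum game in which player 1 minimizes `U` over
`X₁` and player 2 maximizes `U` over `X₂`. -/
def IsNash {E₁ E₂ : Type*} (X₁ : Set E₁) (X₂ : Set E₂) (U : E₁ → E₂ → ℝ)
    (x₁ : E₁) (x₂ : E₂) : Prop :=
  x₁ ∈ X₁ ∧ x₂ ∈ X₂ ∧ ∀ y₁ ∈ X₁, ∀ y₂ ∈ X₂, U x₁ y₂ ≤ U x₁ x₂ ∧ U x₁ x₂ ≤ U y₁ x₂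

/-- `U` is `μ`-strongly convex in `x₁ ∈ X₁` and `μ`-strongly concave in `x₂ ∈ X₂`. -/
def IsStronglyConvexConcave {E₁ E₂ : Type*}
    [NormedAddCommGroup E₁] [NormedSpace ℝ E₁] [NormedAddCommGroup E₂] [NormedSpace ℝ E₂]
    (X₁ : Set E₁) (X₂ : Set E₂) (μ : ℝ) (U : E₁ → E₂ → ℝ) : Prop :=
  (∀ x₂ ∈ X₂, StrongConvexOn X₁ μ (fun x₁ => U x₁ x₂)) ∧
    ∀ x₁ ∈ X₁, StrongConcaveOn X₂ μ (fun x₂ => U x₁ x₂)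

/-! ### Regularizers, Bregman divergence, prox-mapping -/

/-- The Bregman divergence `D_ψ(x, p) = ψ(x) - ψ(p) - ⟨∇ψ(p), x - p⟩`. -/
noncomputable def bregman {E : Type*} [NormedAddCommGroup E] [NormedSpace ℝ E]
    (ψ : E → ℝ) (x p : E) : ℝ :=
  ψ x - ψ p - fderiv ℝ ψ p (x - p)

/-- `ψ` is a `1`-strongly convex differentiable regularizer on `X`. -/
structure IsRegularizer {E : Type*} [NormedAddCommGroup E] [NormedSpace ℝ E]
    (X : Set E) (ψ : E → ℝ) : Prop where
  strongConvex : StrongConvexOn X 1 ψ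
  differentiable : ∀ x ∈ X, DifferentiableAt ℝ ψ x

/-- `p = P_x(y)`, that is, `p` minimizes `x' ↦ ⟨y, x - x'⟩ + D_ψ(x', x)` over `X`. -/
def IsProx {E : Type*} [NormedAddCommGroup E] [NormedSpace ℝ E]
    (X : Set E) (ψ : E → ℝ) (x : E) (y : StrongDual ℝ E) (p : E) : Prop :=
  p ∈ X ∧ ∀ x' ∈ X, y (x - p) + bregman ψ p x ≤ y (x - x') + bregman ψ x' x

/-- `D_ψ(x, y)` is convex in `y`, and `x_k → x` implies `D_ψ(x_k, x) → 0`. -/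
structure BregmanAssumption {E : Type*} [NormedAddCommGroup E] [NormedSpace ℝ E]
    (X : Set E) (ψ : E → ℝ) : Prop where
  convex_right : ∀ x ∈ X, ConvexOn ℝ X (fun y => bregman ψ x y)
  reciprocity : ∀ (z : ℕ → E) (x : E), (∀ k, z k ∈ X) → x ∈ X → Tendsto z atTop (𝓝 x) →
    Tendsto (fun k => bregman ψ (z k) x) atTop (𝓝 0)

/-- `R² = max {D_ψ(x, x') : x, x' ∈ X}`. -/
def IsBregmanDiam {E : Type*} [NormedAddCommGroup E] [NormedSpace ℝ E]
    (X : Set E) (ψ : E → ℝ) (R : ℝ) : Prop :=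
  IsGreatest {r : ℝ | ∃ x ∈ X, ∃ x' ∈ X, r = bregman ψ x x'} (R ^ 2)

/-! ### Networks -/

/-- The weights `W(t)` of one network over the digraphs `G(t)`. An edge from `j` to `i` means that
`i` receives the estimate of `j`. Every agent also keeps a share of its own estimate
(`self_loop`), and the graphs are jointly strongly connected over any `B` consecutive times. -/
structure IsMixing {n : ℕ} (G : ℕ → Digraph (Fin n)) (W : ℕ → Matrix (Fin n) (Fin n) ℝ)
    (η : ℝ) (B : ℕ) : Prop where
  self_loop : ∀ t i, (G t).Adj i i
  weight_of_edge : ∀ t i j, (G t).Adj j i → η ≤ W t i j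
  weight_of_not_edge : ∀ t i j, ¬ (G t).Adj j i → W t i j = 0
  row_sum : ∀ t i, ∑ j, W t i j = 1
  col_sum : ∀ t j, ∑ i, W t i j = 1
  one_le_window : 1 ≤ B
  connected : ∀ k i j,
    Relation.ReflTransGen (fun a b => ∃ t, k ≤ t ∧ t < k + B ∧ (G t).Adj a b) i j

/-- The weights between the two networks over the bipartite digraphs `G(t)`: each agent forms a
weighted average of the estimates of the agents of the other network. -/
structure IsCrossMixing {n₁ n₂ : ℕ} (G : ℕ → Digraph (Fin n₁ ⊕ Fin n₂))
    (W : ℕ → Matrix (Fin n₁ ⊕ Fin n₂) (Fin n₁ ⊕ Fin n₂) ℝ) : Prop where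
  bipartite₁ : ∀ t (i j : Fin n₁), ¬ (G t).Adj (Sum.inl i) (Sum.inl j)
  bipartite₂ : ∀ t (i j : Fin n₂), ¬ (G t).Adj (Sum.inr i) (Sum.inr j)
  nonneg : ∀ t i j, 0 ≤ W t i j
  edge_of_pos : ∀ t i j, 0 < W t i j → (G t).Adj j i
  row_sum₁ : ∀ t (i : Fin n₁), ∑ j : Fin n₂, W t (Sum.inl i) (Sum.inr j) = 1
  row_sum₂ : ∀ t (i : Fin n₂), ∑ j : Fin n₁, W t (Sum.inr i) (Sum.inl j) = 1

/-- `∑ⱼ wⱼ xⱼ(t)`, the average with weights `w` of the estimates at time `t`. -/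
def mix {Ω E : Type*} [NormedAddCommGroup E] [NormedSpace ℝ E] {n : ℕ}
    (w : Fin n → ℝ) (x : Fin n → ℕ → Ω → E) (t : ℕ) (ω : Ω) : E :=
  ∑ j, w j • x j t ω

/-! ### Costs -/

/-- The expected cost `f(x, y) = 𝔼[φ(x, y; ξ)]`. -/
noncomputable def expCost {Ω Z E F : Type*} [MeasurableSpace Ω] (P : Measure Ω) (ξ : Ω → Z)
    (φ : E → F → Z → ℝ) (x : E) (y : F) : ℝ :=
  ∫ ω, φ x y (ξ ω) ∂P

/-- `f` is convex-concave on `O × Y`. -/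
structure IsConvexConcave {E F : Type*} [NormedAddCommGroup E] [NormedSpace ℝ E]
    [NormedAddCommGroup F] [NormedSpace ℝ F] (O : Set E) (Y : Set F) (f : E → F → ℝ) : Prop where
  convex : ∀ y ∈ Y, ConvexOn ℝ O (fun x => f x y)
  concave : ∀ x ∈ O, ConcaveOn ℝ Y (fun y => f x y)

/-- `|f(x, y) - f(x', y')| ≤ L (‖x - x'‖ + ‖y - y'‖)` on `O × Y`. -/
def IsLipschitzCost {E F : Type*} [NormedAddCommGroup E] [NormedAddCommGroup F]
    (O : Set E) (Y : Set F) (L : ℝ) (f : E → F → ℝ) : Prop :=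
  ∀ x ∈ O, ∀ x' ∈ O, ∀ y ∈ Y, ∀ y' ∈ Y, |f x y - f x' y'| ≤ L * (‖x - x'‖ + ‖y - y'‖)

/-- The subdifferential at `x` of a function `h` with domain `O`. -/
def subdiff {E : Type*} [NormedAddCommGroup E] [NormedSpace ℝ E]
    (O : Set E) (h : E → ℝ) (x : E) : Set (StrongDual ℝ E) :=
  {g | ∀ y ∈ O, h x + g (y - x) ≤ h y}

/-! ### The algorithm -/

/-- The `σ`-algebra `ℱ_t` generated by the initial estimates and the samples drawn before `t`. -/
@[reducible] def history {Ω Z E₁ E₂ : Type*} [MeasurableSpace Z] [MeasurableSpace E₁] [MeasurableSpace E₂]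
    {n₁ n₂ : ℕ} (x₁ : Fin n₁ → ℕ → Ω → E₁) (x₂ : Fin n₂ → ℕ → Ω → E₂)
    (ξ₁ : Fin n₁ → ℕ → Ω → Z) (ξ₂ : Fin n₂ → ℕ → Ω → Z) (t : ℕ) : MeasurableSpace Ω :=
  ((⨆ i, MeasurableSpace.comap (x₁ i 0) inferInstance) ⊔
    (⨆ i, MeasurableSpace.comap (x₂ i 0) inferInstance)) ⊔
  ((⨆ i, ⨆ s, ⨆ (_ : s < t), MeasurableSpace.comap (ξ₁ i s) inferInstance) ⊔
    (⨆ i, ⨆ s, ⨆ (_ : s < t), MeasurableSpace.comap (ξ₂ i s) inferInstance))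

/-- The samples `ξ_{l,i}(t)` are independent copies of `ξ`. -/
structure IsIIDSample {Ω Z : Type*} [MeasurableSpace Ω] [MeasurableSpace Z] (P : Measure Ω)
    {n₁ n₂ : ℕ} (ξ : Ω → Z) (ξ₁ : Fin n₁ → ℕ → Ω → Z) (ξ₂ : Fin n₂ → ℕ → Ω → Z) : Prop where
  measurable : Measurable ξ
  measurable₁ : ∀ i t, Measurable (ξ₁ i t)
  measurable₂ : ∀ j t, Measurable (ξ₂ j t)
  identDistrib₁ : ∀ i t, IdentDistrib (ξ₁ i t) ξ P P
  identDistrib₂ : ∀ j t, IdentDistrib (ξ₂ j t) ξ P P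
  indep : iIndepFun (fun (p : (Fin n₁ ⊕ Fin n₂) × ℕ) =>
    Sum.elim (fun i => ξ₁ i p.2) (fun j => ξ₂ j p.2) p.1) P

/-- The updates of the agents of one network. `E` is the space of the network, `F` that of the
other one; `v i t` and `u i t` are the averages that agent `i` forms at time `t` inside its own
network and over the other network, `ghat i t` is its sampled subgradient, `φ i` its sampled cost
with its own strategy as the first argument. -/
structure IsRun {Ω Z E F : Type*} [MeasurableSpace Ω] [NormedAddCommGroup E] [NormedSpace ℝ E]
    [MeasurableSpace E] {n : ℕ}
    (X O : Set E) (ψ : E → ℝ) (α : ℕ → ℝ) (φ : Fin n → E → F → Z → ℝ)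
    (ℱ : ℕ → MeasurableSpace Ω) (ξ : Fin n → ℕ → Ω → Z) (v : Fin n → ℕ → Ω → E)
    (u : Fin n → ℕ → Ω → F) (ghat : Fin n → ℕ → Ω → StrongDual ℝ E)
    (x : Fin n → ℕ → Ω → E) : Prop where
  init_mem : ∀ i ω, x i 0 ω ∈ X
  init_measurable : ∀ i, Measurable (x i 0)
  sampled : ∀ i t ω, ghat i t ω ∈ subdiff O (fun y => φ i y (u i t ω) (ξ i t ω)) (v i t ω)
  sampled_measurable : ∀ i t, StronglyMeasurable[ℱ (t + 1)] (ghat i t)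
  update : ∀ i t ω, IsProx X ψ (v i t ω) (-(α t • ghat i t ω)) (x i (t + 1) ω)

/-- `g i t` is a subgradient of the expected cost at the averages formed by agent `i`, the sampled
subgradient is conditionally unbiased, `𝔼[ghat | ℱ_t] = g`, and has conditional variance
`𝔼[‖g - ghat‖_*² | ℱ_t] ≤ ν²`. -/
structure UnbiasedSampling {Ω E F : Type*} [MeasurableSpace Ω] (P : Measure Ω)
    [NormedAddCommGroup E] [NormedSpace ℝ E] {n : ℕ}
    (O : Set E) (f : Fin n → E → F → ℝ) (ν : ℝ) (ℱ : ℕ → MeasurableSpace Ω)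
    (v : Fin n → ℕ → Ω → E) (u : Fin n → ℕ → Ω → F)
    (g ghat : Fin n → ℕ → Ω → StrongDual ℝ E) : Prop where
  subgradient : ∀ i t, ∀ᵐ ω ∂P, g i t ω ∈ subdiff O (fun y => f i y (u i t ω)) (v i t ω)
  integrable : ∀ i t, Integrable (ghat i t) P
  unbiased : ∀ i t, P[ghat i t | ℱ t] =ᵐ[P] g i t
  sq_integrable : ∀ i t, Integrable (fun ω => ‖g i t ω - ghat i t ω‖ ^ 2) P
  variance_le : ∀ i t,
    P[fun ω => ‖g i t ω - ghat i t ω‖ ^ 2 | ℱ t] ≤ᵐ[P] fun _ => ν ^ 2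

/-- The weighted time average `(∑_{s<t} α(s))⁻¹ ∑_{s<t} α(s) x(s)`. -/
noncomputable def timeAvg {Ω E : Type*} [NormedAddCommGroup E] [NormedSpace ℝ E]
    (α : ℕ → ℝ) (x : ℕ → Ω → E) (t : ℕ) (ω : Ω) : E :=
  (∑ s ∈ Finset.range t, α s)⁻¹ • ∑ s ∈ Finset.range t, α s • x s ω

/-- `‖x̂_{1}(t) - x₁*‖² + ‖x̂_{2}(t) - x₂*‖²`. -/
noncomputable def sqError {Ω E₁ E₂ : Type*} [NormedAddCommGroup E₁] [NormedSpace ℝ E₁]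
    [NormedAddCommGroup E₂] [NormedSpace ℝ E₂] (α : ℕ → ℝ) (x₁ : ℕ → Ω → E₁) (x₂ : ℕ → Ω → E₂)
    (y₁ : E₁) (y₂ : E₂) (t : ℕ) (ω : Ω) : ℝ :=
  ‖timeAvg α x₁ t ω - y₁‖ ^ 2 + ‖timeAvg α x₂ t ω - y₂‖ ^ 2

/-! ### Constants -/

/-- `Γ = (1 - η / (4 n²))⁻²`. -/
noncomputable def Gam (η : ℝ) (n : ℕ) : ℝ := ((1 - η / (4 * (n : ℝ) ^ 2)) ^ 2)⁻¹

/-- `θ = (1 - η / (4 n²))^(1/B)`. -/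
noncomputable def theta (η : ℝ) (n B : ℕ) : ℝ := (1 - η / (4 * (n : ℝ) ^ 2)) ^ (1 / (B : ℝ))

/-- `Λ = 𝔼[maxᵢ ‖xᵢ(0)‖]`, which is `maxᵢ ‖xᵢ(0)‖` when the initial estimates are not random. -/
noncomputable def Lam {Ω E : Type*} [MeasurableSpace Ω] (P : Measure Ω) [NormedAddCommGroup E]
    {n : ℕ} (x : Fin n → ℕ → Ω → E) : ℝ :=
  ∫ ω, ⨆ i, ‖x i 0 ω‖ ∂P

/-- The contribution `4 L n Γ Λ α(0) / (1 - θ) + 2 R²` of one network to `M₁`. -/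
noncomputable def M1part (L η : ℝ) (n B : ℕ) (Λ α0 R : ℝ) : ℝ :=
  4 * L * n * Gam η n * Λ * α0 / (1 - theta η n B) + 2 * R ^ 2

/-- The contribution `4 L (L + ν) (n Γ / (1 - θ) + 2) + (L + ν)² + ν² / 2` of one network to
`M₂`. -/
noncomputable def M2part (L ν η : ℝ) (n B : ℕ) : ℝ :=
  4 * L * (L + ν) * (n * Gam η n / (1 - theta η n B) + 2) + (L + ν) ^ 2 + ν ^ 2 / 2

end DSMD

namespace DSMD

/-! ### Contraction of the disagreement under doubly stochastic matrices -/

/-! At a NE, strong convexity and strong concavity force quadratic growth: `(μ/2)(‖z₁ - y₁‖² + ‖z₂ -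
y₂‖²) ≤ U z₁ y₂ - U y₁ z₂` (`IsNash.gap_ge`). Uniqueness follows at once; existence is Sion's
minimax theorem. By Jensen's inequality for the squared norm, the rate reduces to bounding the
`α`-weighted sum of the expected squared distances of two agents' estimates to the NE.

The gap at time `t` is at most the sum of the linearized regrets of both networks plus `4L` times
their disagreements, the distances of estimates to the network averages (`sq_dist_le_regret`). The
value of `U` at the two averages enters one regret with sign plus and the other with sign minus,
because the costs of the networks average to `U` and `-U`. It cancels, and the gap remains.

The regret is controlled by mirror descent with the potential `∑ⱼ D(z, xⱼ)`. Mixing does not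
increase it, by convexity of `D(z, ·)` and unit column sums; each prox step lowers it by the sampled
linear term up to `α²‖ĝ‖²/2`. The averages `v` are known before the sample is drawn, so in
expectation `ĝ` may be replaced by `g` (`sum_step_mul_integral_le`).

The disagreement comes from averaging perturbed by prox steps of length at most `α(t)‖ĝ‖`.
Transition matrices approach the matrix with entries `1/n` at rate `θ` (`IsMixing.abs_Phi_sub_le`),
so these perturbations are forgotten geometrically. The rate rests on a sorting argument
(`IsMixing.disp_window`): rank the agents by value at the start of a window. Connectivity makes some
edge cross each cut of the ranking, and the first crossing removes from the sum of squares at least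
`η/2` times the squared gap at that cut. -/

theorem sum_mul_sq_sub_sq_sum {n : ℕ} (a x : Fin n → ℝ) (ha : ∑ i, a i = 1) :
    ∑ i, a i * x i ^ 2 - (∑ i, a i * x i) ^ 2
      = 1 / 2 * ∑ i, ∑ j, a i * a j * (x i - x j) ^ 2 := by
  have h : ∀ i j, a i * a j * (x i - x j) ^ 2
      = (a i * x i ^ 2) * a j - 2 * ((a i * x i) * (a j * x j)) + a i * (a j * x j ^ 2) :=
    fun i j => by ring
  simp only [h, Finset.sum_add_distrib, Finset.sum_sub_distrib, ← Finset.mul_sum,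
    ← Finset.sum_mul, ha]
  ring

/-- Cuts `d ∈ D` of the ranked agents that are respected by `x` contribute their squared gaps to
the squared difference of two agents that they separate. -/
theorem sum_sq_gap_le {n : ℕ} {y : ℕ → ℝ} (hy : Monotone y) (r : Fin n → ℕ) (D : Finset ℕ)
    (x : Fin n → ℝ)
    (hx : ∀ d ∈ D, ∀ i, (r i ≤ d → x i ≤ y d) ∧ (d < r i → y (d + 1) ≤ x i)) (i j : Fin n) :
    ∑ d ∈ D, (if r i ≤ d ∧ d < r j then (y (d + 1) - y d) ^ 2 else 0)
      ≤ (x i - x j) ^ 2 := by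
  rw [← Finset.sum_filter]
  set D' := D.filter (fun d => r i ≤ d ∧ d < r j) with hD'
  have hgap : ∀ d, 0 ≤ y (d + 1) - y d := fun d => sub_nonneg.2 (hy (Nat.le_succ d))
  rcases D'.eq_empty_or_nonempty with h | h
  · rw [h]; simpa using sq_nonneg _
  · have hmin := Finset.min'_mem D' h
    have hmax := Finset.max'_mem D' h
    set a := D'.min' h
    set b := D'.max' h
    have hab : a ≤ b := Finset.min'_le _ _ hmax
    rw [hD', Finset.mem_filter] at hmin hmax
    have h1 : x i ≤ y a := (hx a hmin.1 i).1 hmin.2.1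
    have h2 : y (b + 1) ≤ x j := (hx b hmax.1 j).2 hmax.2.2
    -- `D'` need not be an interval of cuts. Its extreme cuts already place `x i` and `x j`, and the
    -- missing gaps are nonnegative, so the telescoping sum between the extremes dominates.
    have h3 : ∑ d ∈ D', (y (d + 1) - y d) ≤ y (b + 1) - y a := by
      rw [← Finset.sum_Ico_sub y (by omega : a ≤ b + 1)]
      refine Finset.sum_le_sum_of_subset_of_nonneg (fun d hd => ?_) (fun d _ _ => hgap d)
      rw [Finset.mem_Ico]
      exact ⟨Finset.min'_le _ _ hd, Nat.lt_succ_of_le (Finset.le_max' _ _ hd)⟩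
    have h4 : 0 ≤ ∑ d ∈ D', (y (d + 1) - y d) := Finset.sum_nonneg fun d _ => hgap d
    calc ∑ d ∈ D', (y (d + 1) - y d) ^ 2 ≤ (∑ d ∈ D', (y (d + 1) - y d)) ^ 2 :=
          Finset.sum_sq_le_sq_sum_of_nonneg fun d _ => hgap d
      _ ≤ (x j - x i) ^ 2 := by gcongr; linarith
      _ = (x i - x j) ^ 2 := by ring

/-- The left side of the cut estimate is a lower bound for a variance. Written as a sum over pairs,
the variance charges every pair with the cuts that separate it; regrouping by cuts yields the mass
below times the mass above. -/
theorem sum_sq_gap_mul_le {n : ℕ} {y : ℕ → ℝ} (hy : Monotone y) (r : Fin n → ℕ) (D : Finset ℕ)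
    (x : Fin n → ℝ)
    (hx : ∀ d ∈ D, ∀ i, (r i ≤ d → x i ≤ y d) ∧ (d < r i → y (d + 1) ≤ x i))
    (a : Fin n → ℝ) (ha0 : ∀ i, 0 ≤ a i) (ha : ∑ i, a i = 1) :
    ∑ d ∈ D, (y (d + 1) - y d) ^ 2 *
        ((∑ i, if r i ≤ d then a i else 0) * ∑ j, if d < r j then a j else 0)
      ≤ ∑ i, a i * x i ^ 2 - (∑ i, a i * x i) ^ 2 := by
  rw [sum_mul_sq_sub_sq_sum a x ha]
  set T : Fin n → Fin n → ℝ := fun i j =>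
    ∑ d ∈ D, (if r i ≤ d ∧ d < r j then (y (d + 1) - y d) ^ 2 else 0) with hT
  -- A cut counts in `T i j` only if `r i < r j`, so one of the two terms vanishes. Summing over
  -- ordered pairs therefore absorbs the factor `1 / 2` of the variance identity.
  have hT2 : ∀ i j, T i j + T j i ≤ (x i - x j) ^ 2 := by
    intro i j
    rcases le_total (r i) (r j) with h | h
    · have : T j i = 0 := Finset.sum_eq_zero fun d _ => if_neg (by omega)
      rw [this, add_zero]; exact sum_sq_gap_le hy r D x hx i j
    · have : T i j = 0 := Finset.sum_eq_zero fun d _ => if_neg (by omega)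
      rw [this, zero_add, ← neg_sub, neg_sq]; exact sum_sq_gap_le hy r D x hx j i
  have h1 : ∑ i, ∑ j, a i * a j * (T i j + T j i) ≤ ∑ i, ∑ j, a i * a j * (x i - x j) ^ 2 := by
    gcongr with i _ j _
    · exact mul_nonneg (ha0 i) (ha0 j)
    · exact hT2 i j
  have h2 : ∑ i, ∑ j, a i * a j * (T i j + T j i) = 2 * ∑ i, ∑ j, a i * a j * T i j := by
    have : ∑ i, ∑ j, a i * a j * T j i = ∑ i, ∑ j, a i * a j * T i j := by
      rw [Finset.sum_comm]
      exact Finset.sum_congr rfl fun i _ => Finset.sum_congr rfl fun j _ => by ring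
    simp only [mul_add, Finset.sum_add_distrib, this]
    ring
  have h3 : ∑ i, ∑ j, a i * a j * T i j = ∑ d ∈ D, (y (d + 1) - y d) ^ 2 *
        ((∑ i, if r i ≤ d then a i else 0) * ∑ j, if d < r j then a j else 0) := by
    simp only [hT, Finset.mul_sum, Finset.sum_mul]
    rw [Finset.sum_congr rfl fun i _ => Finset.sum_comm, Finset.sum_comm]
    refine Finset.sum_congr rfl fun d _ => ?_
    rw [Finset.sum_comm]
    refine Finset.sum_congr rfl fun i _ => Finset.sum_congr rfl fun j _ => ?_
    by_cases h : r j ≤ d <;> by_cases h' : d < r i <;> simp [h, h', mul_comm]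
  rw [← h3]
  linarith

/-- `∑ᵢ (xᵢ - x̄)²`. -/
noncomputable def disp {n : ℕ} (x : Fin n → ℝ) : ℝ := ∑ i, (x i - (∑ j, x j) / n) ^ 2

theorem disp_eq {n : ℕ} (hn : 0 < n) (x : Fin n → ℝ) :
    disp x = ∑ i, x i ^ 2 - (∑ j, x j) ^ 2 / n := by
  have hn' : (n : ℝ) ≠ 0 := by positivity
  simp only [disp, sub_sq, Finset.sum_add_distrib, Finset.sum_sub_distrib, ← Finset.sum_mul,
    ← Finset.mul_sum, Finset.sum_const, Finset.card_univ, Fintype.card_fin, nsmul_eq_mul]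
  field_simp
  ring

theorem disp_nonneg {n : ℕ} (x : Fin n → ℝ) : 0 ≤ disp x :=
  Finset.sum_nonneg fun _ _ => sq_nonneg _

variable {n : ℕ} {G : ℕ → Digraph (Fin n)} {W : ℕ → Matrix (Fin n) (Fin n) ℝ} {η : ℝ} {B : ℕ}

theorem IsMixing.nonneg (h : IsMixing G W η B) (hη : 0 < η) (t : ℕ) (i j : Fin n) :
    0 ≤ W t i j := by
  by_cases hA : (G t).Adj j i
  · exact hη.le.trans (h.weight_of_edge t i j hA)
  · exact (h.weight_of_not_edge t i j hA).ge

theorem IsMixing.sum_mulVec (h : IsMixing G W η B) (t : ℕ) (x : Fin n → ℝ) :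
    ∑ i, (W t).mulVec x i = ∑ i, x i := by
  simp only [Matrix.mulVec, dotProduct]
  rw [Finset.sum_comm]
  exact Finset.sum_congr rfl fun j _ => by rw [← Finset.sum_mul, h.col_sum, one_mul]

/-- Unit column sums distribute `∑ xᵢ²` over the rows, so the loss in one step is the sum of the
variances of `x` under the rows of `W t`. -/
theorem IsMixing.sum_sq_sub (h : IsMixing G W η B) (t : ℕ) (x : Fin n → ℝ) :
    ∑ i, x i ^ 2 - ∑ i, (W t).mulVec x i ^ 2
      = ∑ k, (∑ i, W t k i * x i ^ 2 - (∑ i, W t k i * x i) ^ 2) := by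
  rw [Finset.sum_sub_distrib, Finset.sum_comm]
  simp only [← Finset.sum_mul, h.col_sum, one_mul, Matrix.mulVec, dotProduct]

/-- One step decreases `∑ xᵢ²` at least by `η / 2` times the squared gaps at the respected cuts
which are crossed by an edge. -/
theorem IsMixing.sum_sq_gap_le_sub (h : IsMixing G W η B) (hη : 0 < η) (t : ℕ)
    {y : ℕ → ℝ} (hy : Monotone y) (r : Fin n → ℕ) (D : Finset ℕ) (x : Fin n → ℝ)
    (hx : ∀ d ∈ D, ∀ i, (r i ≤ d → x i ≤ y d) ∧ (d < r i → y (d + 1) ≤ x i))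
    (hD : ∀ d ∈ D, ∃ a b, (G t).Adj a b ∧ ¬ (r a ≤ d ↔ r b ≤ d)) :
    η / 2 * ∑ d ∈ D, (y (d + 1) - y d) ^ 2
      ≤ ∑ i, x i ^ 2 - ∑ i, (W t).mulVec x i ^ 2 := by
  rw [h.sum_sq_sub]
  have hW := h.nonneg hη t
  refine le_trans ?_ (Finset.sum_le_sum fun k _ =>
    sum_sq_gap_mul_le hy r D x hx (W t k) (hW k) (h.row_sum t k))
  rw [Finset.sum_comm, Finset.mul_sum]
  refine Finset.sum_le_sum fun d hd => ?_
  rw [← Finset.mul_sum, mul_comm]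
  refine mul_le_mul_of_nonneg_left ?_ (sq_nonneg _)
  obtain ⟨a, b, hab, hcross⟩ := hD d hd
  have hp : ∀ k, 0 ≤ ∑ i, if r i ≤ d then W t k i else 0 := fun k =>
    Finset.sum_nonneg fun i _ => by split_ifs <;> simp [hW]
  have hq : ∀ k, 0 ≤ ∑ i, if d < r i then W t k i else 0 := fun k =>
    Finset.sum_nonneg fun i _ => by split_ifs <;> simp [hW]
  have hpq : ∀ k, (∑ i, if r i ≤ d then W t k i else 0) + (∑ i, if d < r i then W t k i else 0)
      = 1 := by
    intro k
    rw [← Finset.sum_add_distrib, ← h.row_sum t k]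
    refine Finset.sum_congr rfl fun i _ => ?_
    by_cases hi : r i ≤ d
    · simp [hi, not_lt.2 hi]
    · simp [hi, not_le.1 hi]
  have hp' : ∀ i, r i ≤ d → W t b i ≤ ∑ i, if r i ≤ d then W t b i else 0 := fun i hi => by
    refine le_trans (by simp [hi]) (Finset.single_le_sum (f := fun i => if r i ≤ d then W t b i else 0)
      (fun i _ => by split_ifs <;> simp [hW]) (Finset.mem_univ i))
  have hq' : ∀ i, d < r i → W t b i ≤ ∑ i, if d < r i then W t b i else 0 := fun i hi => by
    refine le_trans (by simp [hi]) (Finset.single_le_sum (f := fun i => if d < r i then W t b i else 0)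
      (fun i _ => by split_ifs <;> simp [hW]) (Finset.mem_univ i))
  refine le_trans ?_ (Finset.single_le_sum
    (f := fun k => (∑ i, if r i ≤ d then W t k i else 0) * ∑ i, if d < r i then W t k i else 0)
    (fun k _ => mul_nonneg (hp k) (hq k)) (Finset.mem_univ b))
  have e1 := h.weight_of_edge t b a hab
  have e2 := h.weight_of_edge t b b (h.self_loop t b)
  -- The head `b` of a crossing edge sees both sides of the cut: its self-loop gives weight `η` on
  -- its own side, the edge from `a` gives weight `η` on the other.
  have key : η ≤ (∑ i, if r i ≤ d then W t b i else 0) ∧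
      η ≤ (∑ i, if d < r i then W t b i else 0) := by
    by_cases ha : r a ≤ d
    · have hb : d < r b := by
        by_contra hb; exact hcross ⟨fun _ => not_lt.1 hb, fun _ => ha⟩
      exact ⟨e1.trans (hp' a ha), e2.trans (hq' b hb)⟩
    · have hb : r b ≤ d := by
        by_contra hb; exact hcross ⟨fun h => absurd h ha, fun h => absurd h hb⟩
      exact ⟨e2.trans (hp' b hb), e1.trans (hq' a (not_le.1 ha))⟩
  have := hpq b
  generalize (∑ i, if r i ≤ d then W t b i else 0) = p at *
  generalize (∑ i, if d < r i then W t b i else 0) = q at *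
  have hq1 : q = 1 - p := by linarith
  subst hq1
  -- From `p, q ≥ η` and `p + q = 1` follow `p q ≥ η (1 - η)` and `η ≤ 1 / 2`, hence `p q ≥ η / 2`.
  nlinarith [mul_nonneg (sub_nonneg.2 key.1) (sub_nonneg.2 key.2)]

theorem IsMixing.disp_mulVec_le (h : IsMixing G W η B) (hη : 0 < η) (hn : 0 < n) (t : ℕ)
    (x : Fin n → ℝ) : disp ((W t).mulVec x) ≤ disp x := by
  rw [disp_eq hn, disp_eq hn, h.sum_mulVec]
  -- With no cuts the decrease estimate only says that the sum of squares does not grow.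
  have := h.sum_sq_gap_le_sub hη t (y := fun _ => 0) (fun _ _ _ => le_rfl) (fun _ => 0) ∅ x
    (by simp) (by simp)
  simp only [Finset.sum_empty, mul_zero] at this
  linarith

/-- No edge crosses the cut `d` of the ranking `r` during `[k, t)`. -/
def Uncrossed (G : ℕ → Digraph (Fin n)) (r : Fin n → ℕ) (k t d : ℕ) : Prop :=
  ∀ s, k ≤ s → s < t → ∀ a b, (G s).Adj a b → (r a ≤ d ↔ r b ≤ d)

/-- As long as no edge crosses the cut, each agent averages only over agents on its own side, and
the bounds `≤ y d` and `≥ y (d + 1)` are stable under averaging. -/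
theorem IsMixing.cut_respected (h : IsMixing G W η B) (hη : 0 < η) {y : ℕ → ℝ} (r : Fin n → ℕ)
    (x : ℕ → Fin n → ℝ) (hx : ∀ t, x (t + 1) = (W t).mulVec (x t)) (k d : ℕ)
    (h0 : ∀ i, (r i ≤ d → x k i ≤ y d) ∧ (d < r i → y (d + 1) ≤ x k i)) (m : ℕ)
    (hU : Uncrossed G r k (k + m) d) (i : Fin n) :
    (r i ≤ d → x (k + m) i ≤ y d) ∧ (d < r i → y (d + 1) ≤ x (k + m) i) := by
  induction m generalizing i with
  | zero => exact h0 i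
  | succ m ih =>
    have ih' := ih (fun s h1 h2 => hU s h1 (by omega))
    have hcr := hU (k + m) (by omega) (by omega)
    have hW := h.nonneg hη (k + m) i
    rw [← add_assoc, hx]
    simp only [Matrix.mulVec, dotProduct]
    have hsum : ∀ c : ℝ, c = ∑ j, W (k + m) i j * c := fun c => by
      rw [← Finset.sum_mul, h.row_sum, one_mul]
    refine ⟨fun hi => ?_, fun hi => ?_⟩
    · rw [hsum (y d)]
      refine Finset.sum_le_sum fun j _ => ?_
      by_cases hA : (G (k + m)).Adj j i
      · exact mul_le_mul_of_nonneg_left ((ih' j).1 ((hcr j i hA).2 hi)) (hW j)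
      · simp [h.weight_of_not_edge _ _ _ hA]
    · rw [hsum (y (d + 1))]
      refine Finset.sum_le_sum fun j _ => ?_
      by_cases hA : (G (k + m)).Adj j i
      · refine mul_le_mul_of_nonneg_left ((ih' j).2 (not_le.1 fun hj => ?_)) (hW j)
        exact absurd ((hcr j i hA).1 hj) (not_le.2 hi)
      · simp [h.weight_of_not_edge _ _ _ hA]

open Classical in
-- Each cut is charged to the step at which it is first crossed. Up to then it is respected, so the
-- one-step decrease applies with the gap measured at time `k`; no cut is charged twice.
theorem IsMixing.sum_crossed_le (h : IsMixing G W η B) (hη : 0 < η) {y : ℕ → ℝ} (hy : Monotone y)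
    (r : Fin n → ℕ) (x : ℕ → Fin n → ℝ) (hx : ∀ t, x (t + 1) = (W t).mulVec (x t)) (k : ℕ)
    (h0 : ∀ d i, (r i ≤ d → x k i ≤ y d) ∧ (d < r i → y (d + 1) ≤ x k i)) (N m : ℕ) :
    η / 2 * ∑ d ∈ (Finset.range N).filter (fun d => ¬ Uncrossed G r k (k + m) d),
        (y (d + 1) - y d) ^ 2
      ≤ ∑ i, x k i ^ 2 - ∑ i, x (k + m) i ^ 2 := by
  induction m with
  | zero =>
    rw [Finset.filter_false_of_mem]
    · simp
    · intro d _
      rw [not_not]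
      exact fun s h1 h2 => absurd h2 (by omega)
  | succ m ih =>
    set D := (Finset.range N).filter
      (fun d => Uncrossed G r k (k + m) d ∧ ¬ Uncrossed G r k (k + (m + 1)) d)
    have hsplit : (Finset.range N).filter (fun d => ¬ Uncrossed G r k (k + (m + 1)) d)
        ⊆ (Finset.range N).filter (fun d => ¬ Uncrossed G r k (k + m) d) ∪ D := by
      intro d hd
      simp only [D, Finset.mem_union, Finset.mem_filter] at hd ⊢
      by_cases hU : Uncrossed G r k (k + m) d
      · exact Or.inr ⟨hd.1, hU, hd.2⟩
      · exact Or.inl ⟨hd.1, hU⟩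
    have hstep := h.sum_sq_gap_le_sub hη (k + m) hy r D (x (k + m))
      (fun d hd i => h.cut_respected hη r x hx k d (h0 d) m (Finset.mem_filter.1 hd).2.1 i)
      (fun d hd => by
        obtain ⟨_, h1, h2⟩ := Finset.mem_filter.1 hd
        by_contra hcon
        push Not at hcon
        refine h2 fun s hs1 hs2 a b hab => ?_
        rcases Nat.lt_succ_iff_lt_or_eq.1 (show s < (k + m) + 1 from hs2) with hs | hs
        · exact h1 s hs1 hs a b hab
        · subst hs; exact hcon a b hab)
    rw [← hx] at hstep
    have hle : ∑ d ∈ (Finset.range N).filter (fun d => ¬ Uncrossed G r k (k + (m + 1)) d),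
        (y (d + 1) - y d) ^ 2
      ≤ ∑ d ∈ (Finset.range N).filter (fun d => ¬ Uncrossed G r k (k + m) d),
        (y (d + 1) - y d) ^ 2 + ∑ d ∈ D, (y (d + 1) - y d) ^ 2 := by
      refine (Finset.sum_le_sum_of_subset_of_nonneg hsplit fun _ _ _ => sq_nonneg _).trans ?_
      rw [← Finset.sum_union_inter]
      exact le_add_of_nonneg_right (Finset.sum_nonneg fun _ _ => sq_nonneg _)
    have := mul_le_mul_of_nonneg_left hle (half_pos hη).le
    rw [mul_add] at this
    have heq : ∑ i, x (k + (m + 1)) i ^ 2 = ∑ i, x (k + m + 1) i ^ 2 := rfl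
    linarith

/-- Every deviation from the mean is at most the spread, which is the sum of the gaps. One factor
`n` counts the agents, the other comes from Cauchy–Schwarz over the `n - 1` gaps. -/
theorem disp_le_sum_sq_gap (hn : 0 < n) {y : ℕ → ℝ} (hy : Monotone y) (r : Fin n → ℕ)
    (hr : ∀ i, r i < n) (x : Fin n → ℝ) (hx : ∀ i, x i = y (r i)) :
    disp x ≤ (n : ℝ) ^ 2 * ∑ d ∈ Finset.range (n - 1), (y (d + 1) - y d) ^ 2 := by
  have hn' : (0 : ℝ) < n := by exact_mod_cast hn
  set ρ := ∑ d ∈ Finset.range (n - 1), (y (d + 1) - y d) with hρ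
  have hρ' : ρ = y (n - 1) - y 0 := Finset.sum_range_sub y _
  have hlo : ∀ i, y 0 ≤ x i := fun i => by rw [hx]; exact hy (Nat.zero_le _)
  have hhi : ∀ i, x i ≤ y (n - 1) := fun i => by rw [hx]; exact hy (by have := hr i; omega)
  have hm1 : y 0 ≤ (∑ j, x j) / n := by
    rw [le_div_iff₀ hn']
    calc y 0 * n = ∑ _j : Fin n, y 0 := by simp [mul_comm]
      _ ≤ _ := Finset.sum_le_sum fun j _ => hlo j
  have hm2 : (∑ j, x j) / n ≤ y (n - 1) := by
    rw [div_le_iff₀ hn']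
    calc ∑ j, x j ≤ ∑ _j : Fin n, y (n - 1) := Finset.sum_le_sum fun j _ => hhi j
      _ = _ := by simp [mul_comm]
  have h1 : disp x ≤ n * ρ ^ 2 := by
    calc disp x ≤ ∑ _i : Fin n, ρ ^ 2 := by
          refine Finset.sum_le_sum fun i _ => ?_
          have := hlo i
          have := hhi i
          exact sq_le_sq' (by linarith) (by linarith)
      _ = _ := by simp
  have h2 : ρ ^ 2 ≤ n * ∑ d ∈ Finset.range (n - 1), (y (d + 1) - y d) ^ 2 := by
    refine (sq_sum_le_card_mul_sum_sq).trans ?_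
    refine mul_le_mul_of_nonneg_right ?_ (Finset.sum_nonneg fun _ _ => sq_nonneg _)
    rw [Finset.card_range]
    exact_mod_cast Nat.sub_le _ _
  nlinarith

/-- Within a window of length `B` every cut of the ranking at time `k` is crossed, so the squared
gaps at all cuts contribute to the decrease. Comparing their sum with `disp` costs `n²`, whence `η /
(2 n²)`. -/
theorem IsMixing.disp_window (h : IsMixing G W η B) (hη : 0 < η) (hn : 0 < n)
    (x : ℕ → Fin n → ℝ) (hx : ∀ t, x (t + 1) = (W t).mulVec (x t)) (k : ℕ) :
    disp (x (k + B)) ≤ (1 - η / (2 * (n : ℝ) ^ 2)) * disp (x k) := by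
  classical
  have hn' : (0 : ℝ) < n := by exact_mod_cast hn
  set σ := Tuple.sort (x k)
  have hσ : Monotone (x k ∘ σ) := Tuple.monotone_sort (x k)
  -- The sorted values, continued as a constant beyond rank `n - 1` so that `y` is monotone on all
  -- of `ℕ`.
  set y : ℕ → ℝ := fun d => x k (σ ⟨min d (n - 1), by omega⟩) with hy
  have hym : Monotone y := fun a b hab => hσ (by
    rw [Fin.mk_le_mk]; exact min_le_min_right _ hab)
  set r : Fin n → ℕ := fun i => (σ.symm i : Fin n).val with hr
  have hrn : ∀ i, r i < n := fun i => (σ.symm i).isLt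
  have hxy : ∀ i, x k i = y (r i) := by
    intro i
    have : (⟨min (r i) (n - 1), by omega⟩ : Fin n) = σ.symm i := by
      ext; simp only; have := hrn i; simp only [hr] at this ⊢; omega
    simp only [hy]
    rw [this, Equiv.apply_symm_apply]
  have h0 : ∀ d i, (r i ≤ d → x k i ≤ y d) ∧ (d < r i → y (d + 1) ≤ x k i) := fun d i => by
    rw [hxy i]; exact ⟨fun hi => hym hi, fun hi => hym hi⟩
  have hmain := h.sum_crossed_le hη hym r x hx k h0 (n - 1) B
  rw [Finset.filter_true_of_mem] at hmain
  · have hd := disp_le_sum_sq_gap hn hym r hrn (x k) hxy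
    have hs : ∀ m, ∑ i, x (k + m) i = ∑ i, x k i := by
      intro m
      induction m with
      | zero => rfl
      | succ m ih => rw [← add_assoc, hx, h.sum_mulVec, ih]
    have hdd : disp (x k) - disp (x (k + B)) = ∑ i, x k i ^ 2 - ∑ i, x (k + B) i ^ 2 := by
      rw [disp_eq hn, disp_eq hn, hs]; ring
    rw [← hdd] at hmain
    have : η / (2 * (n : ℝ) ^ 2) * disp (x k)
        ≤ η / 2 * ∑ d ∈ Finset.range (n - 1), (y (d + 1) - y d) ^ 2 := by
      calc η / (2 * (n : ℝ) ^ 2) * disp (x k)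
          ≤ η / (2 * (n : ℝ) ^ 2) *
            ((n : ℝ) ^ 2 * ∑ d ∈ Finset.range (n - 1), (y (d + 1) - y d) ^ 2) := by gcongr
        _ = _ := by field_simp
    linarith
  · intro d hd hU
    rw [Finset.mem_range] at hd
    have hp := h.connected k (σ ⟨0, hn⟩) (σ ⟨n - 1, by omega⟩)
    -- If the cut were uncrossed, the agents of rank at most `d` would be closed under the edges of
    -- the window. The path from the lowest to the highest rank then contradicts `d < n - 1`.
    have : ∀ j, Relation.ReflTransGen
        (fun a b => ∃ t, k ≤ t ∧ t < k + B ∧ (G t).Adj a b) (σ ⟨0, hn⟩) j → r j ≤ d := by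
      intro j hj
      induction hj with
      | refl => simp [hr]
      | tail _ hab ih =>
        obtain ⟨t, h1, h2, h3⟩ := hab
        exact (hU t h1 h2 _ _ h3).1 ih
    have := this _ hp
    simp only [hr, Equiv.symm_apply_apply] at this
    omega

theorem IsMixing.disp_le_pow (h : IsMixing G W η B) (hη : 0 < η ∧ η < 1) (hn : 0 < n)
    (x : ℕ → Fin n → ℝ) (hx : ∀ t, x (t + 1) = (W t).mulVec (x t)) (k m : ℕ) :
    disp (x (k + m)) ≤ ((1 - η / (4 * (n : ℝ) ^ 2)) ^ (m / B)) ^ 2 * disp (x k) := by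
  have hn' : (1 : ℝ) ≤ n := by exact_mod_cast hn
  have hB := h.one_le_window
  -- Since `disp` is quadratic, its factor is written as a square; this is where `2 n²` becomes `4
  -- n²`.
  have hq : 1 - η / (2 * (n : ℝ) ^ 2) ≤ (1 - η / (4 * (n : ℝ) ^ 2)) ^ 2 := by
    have : η / (2 * (n : ℝ) ^ 2) = 2 * (η / (4 * (n : ℝ) ^ 2)) := by field_simp; ring
    rw [this]
    nlinarith [sq_nonneg (η / (4 * (n : ℝ) ^ 2))]
  have hblock : ∀ c, disp (x (k + B * c)) ≤ ((1 - η / (4 * (n : ℝ) ^ 2)) ^ c) ^ 2 * disp (x k) := by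
    intro c
    induction c with
    | zero => simp
    | succ c ih =>
      rw [mul_add, mul_one, ← add_assoc]
      calc disp (x (k + B * c + B)) ≤ (1 - η / (2 * (n : ℝ) ^ 2)) * disp (x (k + B * c)) :=
            h.disp_window hη.1 hn x hx _
        _ ≤ (1 - η / (4 * (n : ℝ) ^ 2)) ^ 2 * disp (x (k + B * c)) :=
            mul_le_mul_of_nonneg_right hq (disp_nonneg _)
        _ ≤ (1 - η / (4 * (n : ℝ) ^ 2)) ^ 2 *
            (((1 - η / (4 * (n : ℝ) ^ 2)) ^ c) ^ 2 * disp (x k)) := by gcongr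
        _ = _ := by ring
  have hmono : ∀ s c, disp (x (s + c)) ≤ disp (x s) := by
    intro s c
    induction c with
    | zero => exact le_rfl
    | succ c ih =>
      rw [← add_assoc, hx]
      exact (h.disp_mulVec_le hη.1 hn _ _).trans ih
  have : k + m = k + B * (m / B) + m % B := by rw [add_assoc, Nat.div_add_mod]
  rw [this]
  exact (hmono _ _).trans (hblock _)

/-! ### Transition matrices -/

/-- The transition matrix `W(t-1) ⋯ W(s)`. -/
noncomputable def Phi (W : ℕ → Matrix (Fin n) (Fin n) ℝ) (s : ℕ) : ℕ → Matrix (Fin n) (Fin n) ℝ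
  | 0 => 1
  -- The product is empty for all times up to `s`, and the value there is the identity.
  | t + 1 => if s ≤ t then W t * Phi W s t else 1

theorem Phi_self (W : ℕ → Matrix (Fin n) (Fin n) ℝ) (s : ℕ) : Phi W s s = 1 := by
  cases s with
  | zero => rfl
  | succ s => simp [Phi]

theorem Phi_succ (W : ℕ → Matrix (Fin n) (Fin n) ℝ) {s t : ℕ} (h : s ≤ t) :
    Phi W s (t + 1) = W t * Phi W s t := by simp [Phi, h]

theorem one_sub_pos_lt (hη : 0 < η ∧ η < 1) (hn : 0 < n) :
    0 < 1 - η / (4 * (n : ℝ) ^ 2) ∧ 1 - η / (4 * (n : ℝ) ^ 2) < 1 := by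
  have hn' : (1 : ℝ) ≤ n := by exact_mod_cast hn
  have : 0 < η / (4 * (n : ℝ) ^ 2) := div_pos hη.1 (by positivity)
  have h2 : η / (4 * (n : ℝ) ^ 2) < 1 := by
    rw [div_lt_one (by positivity)]
    nlinarith
  constructor <;> linarith

theorem theta_pos (hη : 0 < η ∧ η < 1) (hn : 0 < n) : 0 < theta η n B :=
  Real.rpow_pos_of_pos (one_sub_pos_lt hη hn).1 _

theorem theta_lt_one (hη : 0 < η ∧ η < 1) (hn : 0 < n) (hB : 1 ≤ B) : theta η n B < 1 :=
  Real.rpow_lt_one (one_sub_pos_lt hη hn).1.le (one_sub_pos_lt hη hn).2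
    (one_div_pos.2 (by exact_mod_cast hB))

theorem Gam_pos (hη : 0 < η ∧ η < 1) (hn : 0 < n) : 0 < Gam η n :=
  inv_pos.2 (pow_pos (one_sub_pos_lt hη hn).1 2)

/-- Rounding `m / B` down loses less than one power of the base, and `Γ`, the inverse of its square,
pays for it with one power to spare. -/
theorem pow_div_le (hη : 0 < η ∧ η < 1) (hn : 0 < n) (hB : 1 ≤ B) (m : ℕ) :
    (1 - η / (4 * (n : ℝ) ^ 2)) ^ (m / B) ≤ Gam η n * theta η n B ^ m := by
  obtain ⟨hq0, hq1⟩ := one_sub_pos_lt (n := n) hη hn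
  unfold Gam theta
  set q := 1 - η / (4 * (n : ℝ) ^ 2)
  have hB' : (0 : ℝ) < B := by exact_mod_cast hB
  have h1 : (m : ℝ) / B ≤ (m / B : ℕ) + 1 := by
    rw [div_le_iff₀ hB']
    have : m < B * (m / B + 1) := Nat.lt_mul_div_succ m hB
    have h2 : (m : ℝ) < B * ((m / B : ℕ) + 1) := by exact_mod_cast this
    linarith
  have h2 : q ^ (m / B) * q ^ 2 ≤ (q ^ (1 / (B : ℝ))) ^ m := by
    rw [← Real.rpow_natCast (q ^ (1 / (B : ℝ))) m, ← Real.rpow_mul hq0.le, ← pow_add,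
      ← Real.rpow_natCast q]
    refine Real.rpow_le_rpow_of_exponent_ge hq0 hq1.le ?_
    push_cast
    have : 1 / (B : ℝ) * m = m / B := by ring
    rw [this]
    linarith
  rw [inv_mul_eq_div, le_div_iff₀ (by positivity)]
  exact h2

theorem disp_single_le_one (hn : 0 < n) (j : Fin n) :
    disp (fun i => (1 : Matrix (Fin n) (Fin n) ℝ) i j) ≤ 1 := by
  rw [disp_eq hn]
  have h1 : ∑ i, (1 : Matrix (Fin n) (Fin n) ℝ) i j ^ 2 = 1 := by
    simp [Matrix.one_apply]
  rw [h1]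
  have : 0 ≤ (∑ i, (1 : Matrix (Fin n) (Fin n) ℝ) i j) ^ 2 / (n : ℝ) := by positivity
  linarith

theorem IsMixing.Phi_col_sum (h : IsMixing G W η B) (s m : ℕ) (j : Fin n) :
    ∑ i, Phi W s (s + m) i j = 1 := by
  induction m with
  | zero => simp [Phi_self, Matrix.one_apply]
  | succ m ih =>
    rw [← add_assoc, Phi_succ W (Nat.le_add_right s m)]
    exact (h.sum_mulVec (s + m) (fun i => Phi W s (s + m) i j)).trans ih

/-- The entries of the transition matrices converge geometrically to `1 / n`. -/
theorem IsMixing.abs_Phi_sub_le (h : IsMixing G W η B) (hη : 0 < η ∧ η < 1) (hn : 0 < n)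
    (s m : ℕ) (i j : Fin n) :
    |Phi W s (s + m) i j - 1 / n| ≤ Gam η n * theta η n B ^ m := by
  refine le_trans ?_ (pow_div_le hη hn h.one_le_window m)
  have hshift : ∀ t, (fun i => Phi W s (s + (t + 1)) i j)
      = (W (s + t)).mulVec (fun i => Phi W s (s + t) i j) := by
    intro t
    rw [← add_assoc, Phi_succ W (Nat.le_add_right s t)]
    rfl
  -- The recursion for the columns of `Phi W s` holds only from time `s` on, so the network is
  -- restarted there. Column `j` starts from a unit vector, and its mean stays `1 / n`.
  have hG : IsMixing (fun t => G (s + t)) (fun t => W (s + t)) η B :=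
    { self_loop := fun t => h.self_loop _
      weight_of_edge := fun t => h.weight_of_edge _
      weight_of_not_edge := fun t => h.weight_of_not_edge _
      row_sum := fun t => h.row_sum _
      col_sum := fun t => h.col_sum _
      one_le_window := h.one_le_window
      connected := fun k i j => by
        refine Relation.ReflTransGen.mono ?_ i j (h.connected (s + k) i j)
        rintro a b ⟨t, h1, h2, h3⟩
        refine ⟨t - s, by omega, by omega, ?_⟩
        rwa [Nat.add_sub_cancel' (by omega)] }
  have hd := hG.disp_le_pow hη hn (fun t i => Phi W s (s + t) i j) hshift 0 m
  simp only [add_zero, zero_add, Phi_self] at hd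
  have hq := (one_sub_pos_lt (n := n) hη hn).1
  have h1 : (Phi W s (s + m) i j - 1 / n) ^ 2 ≤ ((1 - η / (4 * (n : ℝ) ^ 2)) ^ (m / B)) ^ 2 := by
    calc (Phi W s (s + m) i j - 1 / n) ^ 2 ≤ disp (fun i => Phi W s (s + m) i j) := by
          unfold disp
          rw [h.Phi_col_sum s m j]
          exact Finset.single_le_sum (f := fun i => (Phi W s (s + m) i j - 1 / n) ^ 2)
            (fun _ _ => sq_nonneg _) (Finset.mem_univ i)
      _ ≤ _ := hd
      _ ≤ ((1 - η / (4 * (n : ℝ) ^ 2)) ^ (m / B)) ^ 2 * 1 := by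
          gcongr
          exact disp_single_le_one hn j
      _ = _ := mul_one _
  exact abs_le_of_sq_le_sq h1 (by positivity)

/-! ### Perturbed averaging -/

/-- The average `(1 / n) ∑ⱼ xⱼ`. -/
noncomputable def avg {E : Type*} [NormedAddCommGroup E] [NormedSpace ℝ E] (x : Fin n → E) : E :=
  (1 / (n : ℝ)) • ∑ j, x j

section Perturbed

variable {E : Type*} [NormedAddCommGroup E] [NormedSpace ℝ E]

/-- Variation of constants: the perturbation `e s` enters at time `s + 1` and is transported from
there. -/
theorem eq_sum_Phi (x e : ℕ → Fin n → E) (hx : ∀ t i, x (t + 1) i = ∑ j, W t i j • x t j + e t i)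
    (t : ℕ) (i : Fin n) :
    x t i = ∑ j, Phi W 0 t i j • x 0 j
      + ∑ s ∈ Finset.range t, ∑ j, Phi W (s + 1) t i j • e s j := by
  have hmul : ∀ (s t : ℕ) (_ : s ≤ t) (z : Fin n → E) (i : Fin n),
      ∑ j, W t i j • ∑ k, Phi W s t j k • z k = ∑ k, Phi W s (t + 1) i k • z k := by
    intro s t hst z i
    rw [Phi_succ W hst]
    simp only [Finset.smul_sum, Matrix.mul_apply, Finset.sum_smul, smul_smul]
    rw [Finset.sum_comm]
  induction t generalizing i with
  | zero => simp [Phi_self, Matrix.one_apply]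
  | succ t ih =>
    rw [hx, Finset.sum_range_succ, Phi_self]
    simp only [ih, smul_add, Finset.sum_add_distrib, hmul 0 t (Nat.zero_le t)]
    rw [add_assoc]
    congr 2
    · simp only [Finset.smul_sum (s := Finset.range t)]
      rw [Finset.sum_comm]
      refine Finset.sum_congr rfl fun s hs => ?_
      exact hmul (s + 1) t (Finset.mem_range.1 hs) (e s) i
    · simp [Matrix.one_apply]

theorem IsMixing.avg_eq (h : IsMixing G W η B) (x e : ℕ → Fin n → E)
    (hx : ∀ t i, x (t + 1) i = ∑ j, W t i j • x t j + e t i) (t : ℕ) :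
    avg (x t) = avg (x 0) + ∑ s ∈ Finset.range t, avg (e s) := by
  induction t with
  | zero => simp
  | succ t ih =>
    rw [Finset.sum_range_succ, ← add_assoc, ← ih]
    unfold avg
    rw [← smul_add, Finset.sum_congr rfl fun i _ => hx t i, Finset.sum_add_distrib,
      Finset.sum_comm]
    simp only [← Finset.sum_smul, h.col_sum, one_smul]

/-- The distance of the estimates to their average under perturbed averaging. -/
theorem IsMixing.norm_sub_avg_le (h : IsMixing G W η B) (hη : 0 < η ∧ η < 1) (hn : 0 < n)
    (x e : ℕ → Fin n → E) (hx : ∀ t i, x (t + 1) i = ∑ j, W t i j • x t j + e t i)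
    (t : ℕ) (i : Fin n) :
    ‖x t i - avg (x t)‖ ≤ Gam η n * theta η n B ^ t * ∑ j, ‖x 0 j‖
      + ∑ s ∈ Finset.range t, Gam η n * theta η n B ^ (t - 1 - s) * ∑ j, ‖e s j‖ := by
  have hb : ∀ (s : ℕ) (_ : s ≤ t) (z : Fin n → E),
      ‖∑ j, Phi W s t i j • z j - avg z‖ ≤ Gam η n * theta η n B ^ (t - s) * ∑ j, ‖z j‖ := by
    intro s hs z
    have : ∑ j, Phi W s t i j • z j - avg z = ∑ j, (Phi W s t i j - 1 / n) • z j := by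
      simp only [avg, Finset.smul_sum, sub_smul, Finset.sum_sub_distrib]
    rw [this, Finset.mul_sum]
    refine norm_sum_le_of_le _ fun j _ => ?_
    rw [norm_smul, Real.norm_eq_abs]
    refine mul_le_mul_of_nonneg_right ?_ (norm_nonneg _)
    have := h.abs_Phi_sub_le hη hn s (t - s) i j
    rwa [Nat.add_sub_cancel' hs] at this
  have : x t i - avg (x t) = (∑ j, Phi W 0 t i j • x 0 j - avg (x 0))
      + ∑ s ∈ Finset.range t, (∑ j, Phi W (s + 1) t i j • e s j - avg (e s)) := by
    rw [Finset.sum_sub_distrib, h.avg_eq x e hx t, eq_sum_Phi x e hx t i]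
    abel
  rw [this]
  refine (norm_add_le _ _).trans (add_le_add (hb 0 (Nat.zero_le _) _) ?_)
  refine norm_sum_le_of_le _ fun s hs => ?_
  have := hb (s + 1) (Finset.mem_range.1 hs) (e s)
  rwa [show t - (s + 1) = t - 1 - s by omega] at this

end Perturbed

/-! ### Strong convexity, Bregman divergence and prox-mapping -/

section Bregman

variable {E : Type*} [NormedAddCommGroup E] [NormedSpace ℝ E]

/-- A strongly convex function grows quadratically away from its minimizer. -/
theorem add_sq_le_of_strongConvexOn {X : Set E} {m : ℝ} {h : E → ℝ} (hh : StrongConvexOn X m h)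
    {p : E} (hp : p ∈ X) (hmin : ∀ x ∈ X, h p ≤ h x) {x : E} (hx : x ∈ X) :
    h p + m / 2 * ‖x - p‖ ^ 2 ≤ h x := by
  have key : ∀ t ∈ Set.Ioo (0 : ℝ) 1, (1 - t) * (m / 2 * ‖x - p‖ ^ 2) ≤ h x - h p := by
    intro t ht
    have h1 := hh.2 hx hp ht.1.le (sub_nonneg.2 ht.2.le) (by ring)
    have h2 := hmin _ (hh.1 hx hp ht.1.le (sub_nonneg.2 ht.2.le) (by ring))
    simp only [smul_eq_mul] at h1
    have h3 : t * ((1 - t) * (m / 2 * ‖x - p‖ ^ 2)) ≤ t * (h x - h p) := by linarith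
    exact le_of_mul_le_mul_left h3 ht.1
  have hlim : Tendsto (fun t : ℝ => (1 - t) * (m / 2 * ‖x - p‖ ^ 2)) (𝓝[>] 0)
      (𝓝 ((1 - 0) * (m / 2 * ‖x - p‖ ^ 2))) :=
    (Continuous.tendsto (by fun_prop) 0).mono_left nhdsWithin_le_nhds
  have := le_of_tendsto hlim (by
    filter_upwards [Ioo_mem_nhdsGT (zero_lt_one' ℝ)] with t ht using key t ht)
  linarith

/-- Strong convexity on the segment from `v` to `p`, divided by `t`, bounds the difference quotient
of `ψ` at `v`; let `t` decrease to `0`. -/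
theorem IsRegularizer.half_sq_le_bregman {X : Set E} {ψ : E → ℝ} (hψ : IsRegularizer X ψ)
    {p v : E} (hp : p ∈ X) (hv : v ∈ X) : 1 / 2 * ‖p - v‖ ^ 2 ≤ bregman ψ p v := by
  have key : ∀ t ∈ Set.Ioo (0 : ℝ) 1, t⁻¹ • (ψ (v + (0 + t) • (p - v)) - ψ (v + (0 : ℝ) • (p - v)))
      ≤ ψ p - ψ v - (1 - t) * (1 / 2 * ‖p - v‖ ^ 2) := by
    intro t ht
    have h1 := hψ.strongConvex.2 hp hv ht.1.le (sub_nonneg.2 ht.2.le) (by ring)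
    simp only [smul_eq_mul] at h1
    have h2 : v + (0 + t) • (p - v) = t • p + (1 - t) • v := by module
    rw [h2, zero_smul, add_zero, smul_eq_mul, inv_mul_le_iff₀ ht.1]
    linarith
  have hd : HasDerivAt (fun s : ℝ => ψ (v + s • (p - v))) (fderiv ℝ ψ v (p - v)) 0 := by
    have h1 : HasFDerivAt ψ (fderiv ℝ ψ v) (v + (0 : ℝ) • (p - v)) := by
      simpa using (hψ.differentiable v hv).hasFDerivAt
    have h2 : HasDerivAt (fun s : ℝ => v + s • (p - v)) (p - v) 0 := by
      simpa using ((hasDerivAt_id (0 : ℝ)).smul_const (p - v)).const_add v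
    exact h1.comp_hasDerivAt (0 : ℝ) h2
  have hlim : Tendsto (fun t : ℝ => ψ p - ψ v - (1 - t) * (1 / 2 * ‖p - v‖ ^ 2)) (𝓝[>] 0)
      (𝓝 (ψ p - ψ v - (1 - 0) * (1 / 2 * ‖p - v‖ ^ 2))) :=
    (Continuous.tendsto (by fun_prop) 0).mono_left nhdsWithin_le_nhds
  have := le_of_tendsto_of_tendsto hd.tendsto_slope_zero_right hlim (by
    filter_upwards [Ioo_mem_nhdsGT (zero_lt_one' ℝ)] with t ht using key t ht)
  unfold bregman
  linarith

theorem IsRegularizer.bregman_nonneg {X : Set E} {ψ : E → ℝ} (hψ : IsRegularizer X ψ)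
    {p v : E} (hp : p ∈ X) (hv : v ∈ X) : 0 ≤ bregman ψ p v :=
  le_trans (by positivity) (hψ.half_sq_le_bregman hp hv)

/-- The three-point inequality of mirror descent. -/
theorem IsProx.apply_sub_le {X : Set E} {ψ : E → ℝ} (hψ : IsRegularizer X ψ) {v p : E}
    {y : StrongDual ℝ E} (h : IsProx X ψ v y p) {x : E} (hx : x ∈ X) :
    y (x - p) ≤ bregman ψ x v - bregman ψ x p - bregman ψ p v := by
  have hd : HasFDerivWithinAt (fun x' => y (v - x') + bregman ψ x' v)
      (-y + (fderiv ℝ ψ p - fderiv ℝ ψ v)) X p := by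
    have h1 : HasFDerivAt (fun x' : E => y (v - x')) (-y) p := by
      have : HasFDerivAt (fun x' : E => v - x') (-ContinuousLinearMap.id ℝ E) p :=
        (hasFDerivAt_id p).const_sub v
      have := y.hasFDerivAt.comp p this
      convert! this using 1
      ext; simp
    have h2 : HasFDerivAt (fun x' : E => bregman ψ x' v) (fderiv ℝ ψ p - fderiv ℝ ψ v) p := by
      unfold bregman
      have h3 : HasFDerivAt (fun x' : E => fderiv ℝ ψ v (x' - v)) (fderiv ℝ ψ v) p :=
        (fderiv ℝ ψ v).hasFDerivAt.comp p ((hasFDerivAt_id p).sub_const v)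
      exact ((hψ.differentiable p h.1).hasFDerivAt.sub_const (ψ v)).sub h3
    exact (h1.add h2).hasFDerivWithinAt
  have hmin : IsMinOn (fun x' => y (v - x') + bregman ψ x' v) X p := fun x' hx' => h.2 x' hx'
  -- First-order optimality of `p` in the feasible direction `x - p`. The three divergences combine
  -- to `(∇ψ(p) - ∇ψ(v))(x - p)`, so this is already the claim.
  have := hmin.localize.hasFDerivWithinAt_nonneg hd
    (sub_mem_posTangentConeAt_of_segment_subset (hψ.strongConvex.1.segment_subset h.1 hx))
  simp only [add_apply, sub_apply, neg_apply, map_sub] at this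
  unfold bregman
  simp only [map_sub]
  linarith

/-- In the three-point inequality at `x = v` the two divergences between `v` and `p` remain, and
together they are at least `‖p - v‖²`. -/
theorem IsProx.norm_sub_le {X : Set E} {ψ : E → ℝ} (hψ : IsRegularizer X ψ) {v p : E}
    {y : StrongDual ℝ E} (h : IsProx X ψ v y p) (hv : v ∈ X) : ‖p - v‖ ≤ ‖y‖ := by
  have h1 := h.apply_sub_le hψ hv
  have h2 := hψ.half_sq_le_bregman h.1 hv
  have h3 := hψ.half_sq_le_bregman hv h.1
  have h4 : bregman ψ v v = 0 := by simp [bregman]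
  have h5 : |y (v - p)| ≤ ‖y‖ * ‖v - p‖ := y.le_opNorm _
  rw [norm_sub_rev v p] at h3 h5
  have h6 : ‖p - v‖ * ‖p - v‖ ≤ ‖y‖ * ‖p - v‖ := by
    nlinarith [neg_abs_le (y (v - p))]
  rcases (norm_nonneg (p - v)).eq_or_lt with h7 | h7
  · rw [← h7]; exact norm_nonneg _
  · exact le_of_mul_le_mul_right h6 h7

/-- The per-step inequality of mirror descent. -/
theorem IsProx.mul_apply_sub_le {X : Set E} {ψ : E → ℝ} (hψ : IsRegularizer X ψ) {v p : E}
    {g : StrongDual ℝ E} {a : ℝ} (h : IsProx X ψ v (-(a • g)) p) (hv : v ∈ X)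
    {x : E} (hx : x ∈ X) :
    a * g (v - x) ≤ bregman ψ x v - bregman ψ x p + a ^ 2 / 2 * ‖g‖ ^ 2 := by
  have h1 := h.apply_sub_le hψ hx
  have h2 := hψ.half_sq_le_bregman h.1 hv
  simp only [neg_apply, smul_apply, smul_eq_mul, map_sub] at h1 ⊢
  have h3 : |a * g (v - p)| ≤ |a| * ‖g‖ * ‖p - v‖ := by
    rw [abs_mul, mul_assoc, norm_sub_rev p v]
    exact mul_le_mul_of_nonneg_left (g.le_opNorm _) (abs_nonneg a)
  have h4 := (le_abs_self _).trans h3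
  rw [map_sub] at h4
  have h5 : (|a| * ‖g‖) ^ 2 = a ^ 2 * ‖g‖ ^ 2 := by rw [mul_pow, sq_abs]
  -- Young's inequality for `a * g (v - p)`; the resulting `‖p - v‖² / 2` is absorbed by `D(p, v)`.
  nlinarith [sq_nonneg (|a| * ‖g‖ - ‖p - v‖)]

/-- The prox-mapping is a continuous function of `∇ψ(x) + y`. -/
theorem exists_continuous_of_isProx {X : Set E} {ψ : E → ℝ} (hX : X.Nonempty ∧ IsCompact X)
    (hψ : IsRegularizer X ψ) :
    ∃ Q : StrongDual ℝ E → E, Continuous Q ∧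
      ∀ v y p, IsProx X ψ v y p → p = Q (fderiv ℝ ψ v + y) := by
  have hcont : ContinuousOn ψ X := fun x hx => (hψ.differentiable x hx).continuousAt.continuousWithinAt
  have hex : ∀ z : StrongDual ℝ E, ∃ p ∈ X, ∀ x ∈ X, ψ p - z p ≤ ψ x - z x := fun z =>
    hX.2.exists_isMinOn hX.1 (hcont.sub z.continuous.continuousOn)
  have hlip : ∀ (z z' : StrongDual ℝ E) (p p' : E), p ∈ X → p' ∈ X →
      (∀ x ∈ X, ψ p - z p ≤ ψ x - z x) → (∀ x ∈ X, ψ p' - z' p' ≤ ψ x - z' x) →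
      ‖p - p'‖ ≤ ‖z - z'‖ := by
    intro z z' p p' hp hp' hm hm'
    have hsc : ∀ z : StrongDual ℝ E, StrongConvexOn X 1 (fun x => ψ x - z x) := by
      refine fun z => ⟨hψ.strongConvex.1, fun x hx y hy a b ha hb hab => ?_⟩
      have := hψ.strongConvex.2 hx hy ha hb hab
      simp only [map_add, map_smul, smul_eq_mul] at this ⊢
      linarith
    -- Adding the quadratic growth at both minimizers gives `‖p - p'‖² ≤ (z - z')(p - p')`, so the
    -- minimizer is `1`-Lipschitz in the dual variable.
    have h1 := add_sq_le_of_strongConvexOn (hsc z) hp hm hp'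
    have h2 := add_sq_le_of_strongConvexOn (hsc z') hp' hm' hp
    rw [norm_sub_rev p' p] at h1
    have h3 : (z - z') (p - p') ≤ ‖z - z'‖ * ‖p - p'‖ :=
      (le_abs_self _).trans ((z - z').le_opNorm _)
    simp only [sub_apply, map_sub] at h3
    have h4 : ‖p - p'‖ * ‖p - p'‖ ≤ ‖z - z'‖ * ‖p - p'‖ := by nlinarith
    rcases (norm_nonneg (p - p')).eq_or_lt with h7 | h7
    · rw [← h7]; exact norm_nonneg _
    · exact le_of_mul_le_mul_right h4 h7
  choose Q hQ hQmin using hex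
  refine ⟨Q, ?_, fun v y p h => ?_⟩
  · refine (LipschitzWith.of_dist_le_mul (K := 1) fun z z' => ?_).continuous
    rw [dist_eq_norm, dist_eq_norm, NNReal.coe_one, one_mul]
    exact hlip z z' _ _ (hQ z) (hQ z') (hQmin z) (hQmin z')
  · have hm : ∀ x ∈ X, ψ p - (fderiv ℝ ψ v + y) p ≤ ψ x - (fderiv ℝ ψ v + y) x := by
      intro x hx
      have := h.2 x hx
      simp only [bregman, map_sub, add_apply] at this ⊢
      linarith
    have := hlip _ _ _ _ h.1 (hQ (fderiv ℝ ψ v + y)) hm (hQmin _)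
    rw [sub_self, norm_zero] at this
    exact sub_eq_zero.1 (norm_le_zero_iff.1 this)

/-- The gradient of `ψ` is Borel measurable even where it is not continuous, and the prox point
depends continuously on `∇ψ(v) + y`. This keeps the iterates adapted to the history. -/
theorem IsProx.measurable [FiniteDimensional ℝ E] [MeasurableSpace E] [BorelSpace E]
    {Ω : Type*} {m : MeasurableSpace Ω} {X : Set E} {ψ : E → ℝ} (hX : X.Nonempty ∧ IsCompact X)
    (hψ : IsRegularizer X ψ) {v p : Ω → E} {y : Ω → StrongDual ℝ E} (hv : Measurable v)
    (hy : StronglyMeasurable y) (h : ∀ ω, IsProx X ψ (v ω) (y ω) (p ω)) : Measurable p := by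
  obtain ⟨Q, hQ, hQp⟩ := exists_continuous_of_isProx hX hψ
  have : p = fun ω => Q (fderiv ℝ ψ (v ω) + y ω) := funext fun ω => hQp _ _ _ (h ω)
  rw [this]
  have hfin : FiniteDimensional ℝ (E →L[ℝ] ℝ) := inferInstance
  have : ProperSpace (E →L[ℝ] ℝ) := FiniteDimensional.proper_real _
  exact hQ.measurable.comp (((measurable_fderiv ℝ ψ).comp hv).add hy.measurable)

/-- Subgradients of a Lipschitz function on an open set are bounded by the constant. -/
theorem norm_le_of_mem_subdiff {O : Set E} {h : E → ℝ} {x : E} {g : StrongDual ℝ E} {L : ℝ}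
    (hO : IsOpen O) (hx : x ∈ O) (hL : 0 ≤ L) (hh : ∀ y ∈ O, h y - h x ≤ L * ‖y - x‖)
    (hg : g ∈ subdiff O h x) : ‖g‖ ≤ L := by
  obtain ⟨ε, hε, hball⟩ := Metric.isOpen_iff.1 hO x hx
  have key : ∀ z : E, ‖z‖ < ε → g z ≤ L * ‖z‖ := by
    intro z hz
    have hm : x + z ∈ O := hball (by simpa [dist_eq_norm] using hz)
    have h1 := hg _ hm
    have h2 := hh _ hm
    rw [add_sub_cancel_left] at h1 h2
    linarith
  refine ContinuousLinearMap.opNorm_le_of_ball hε hL fun z hz => ?_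
  rw [mem_ball_zero_iff] at hz
  rw [Real.norm_eq_abs, abs_le]
  have h1 := key z hz
  have h2 := key (-z) (by rwa [norm_neg])
  rw [map_neg, norm_neg] at h2
  constructor <;> linarith

end Bregman

/-! ### Averages -/

theorem mix_mem {Ω E : Type*} [NormedAddCommGroup E] [NormedSpace ℝ E] {n : ℕ} {X : Set E}
    (hX : Convex ℝ X) {w : Fin n → ℝ} (hw : ∀ j, 0 ≤ w j) (hw1 : ∑ j, w j = 1)
    {x : Fin n → ℕ → Ω → E} {t : ℕ} {ω : Ω} (hx : ∀ j, x j t ω ∈ X) : mix w x t ω ∈ X :=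
  hX.sum_mem (fun j _ => hw j) hw1 fun j _ => hx j

theorem avg_mem {E : Type*} [NormedAddCommGroup E] [NormedSpace ℝ E] {n : ℕ} (hn : 0 < n)
    {X : Set E} (hX : Convex ℝ X) {x : Fin n → E} (hx : ∀ j, x j ∈ X) : avg x ∈ X := by
  have hn' : (n : ℝ) ≠ 0 := by positivity
  unfold avg
  rw [Finset.smul_sum]
  refine hX.sum_mem (fun j _ => by positivity) ?_ fun j _ => hx j
  simp [hn']

/-- A weighted average stays within the distance of its terms to a point. -/
theorem norm_mix_sub_le {Ω E : Type*} [NormedAddCommGroup E] [NormedSpace ℝ E] {n : ℕ}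
    {w : Fin n → ℝ} (hw : ∀ j, 0 ≤ w j) (hw1 : ∑ j, w j = 1)
    {x : Fin n → ℕ → Ω → E} {t : ℕ} {ω : Ω} {c : E} {r : ℝ} (hx : ∀ j, ‖x j t ω - c‖ ≤ r) :
    ‖mix w x t ω - c‖ ≤ r := by
  have : mix w x t ω ∈ Metric.closedBall c r :=
    mix_mem (convex_closedBall c r) hw hw1 fun j => by
      rw [Metric.mem_closedBall, dist_eq_norm]; exact hx j
  rwa [Metric.mem_closedBall, dist_eq_norm] at this

theorem measurable_mix {Ω E : Type*} {m : MeasurableSpace Ω} [NormedAddCommGroup E]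
    [NormedSpace ℝ E] [FiniteDimensional ℝ E] [MeasurableSpace E] [BorelSpace E] {n : ℕ}
    (w : Fin n → ℝ) {x : Fin n → ℕ → Ω → E} {t : ℕ} (hx : ∀ j, Measurable (x j t)) :
    Measurable (mix w x t) := by
  have : ProperSpace E := FiniteDimensional.proper_real E
  unfold mix
  exact Finset.measurable_fun_sum _ fun j _ => (hx j).const_smul (w j)

/-! ### Scalar sums -/

theorem geom_sum_le {θ : ℝ} (h0 : 0 ≤ θ) (h1 : θ < 1) (T : ℕ) :
    ∑ t ∈ Finset.range T, θ ^ t ≤ 1 / (1 - θ) := by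
  rw [le_div_iff₀ (by linarith), mul_comm, mul_neg_geom_sum]
  linarith [pow_nonneg h0 T]

/-- The inner sums satisfy `S (t + 1) = θ * S t + a t`; summing this recursion telescopes, so no
exchange of the order of summation is needed. -/
theorem sum_sum_geom_le {θ : ℝ} (h0 : 0 ≤ θ) (h1 : θ < 1) {a : ℕ → ℝ} (ha : ∀ t, 0 ≤ a t) (T : ℕ) :
    ∑ t ∈ Finset.range T, ∑ s ∈ Finset.range t, θ ^ (t - 1 - s) * a s
      ≤ (∑ s ∈ Finset.range T, a s) / (1 - θ) := by
  set S : ℕ → ℝ := fun t => ∑ s ∈ Finset.range t, θ ^ (t - 1 - s) * a s with hS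
  have hstep : ∀ t, S (t + 1) = θ * S t + a t := by
    intro t
    simp only [hS]
    rw [Finset.sum_range_succ, Finset.mul_sum]
    congr 1
    · refine Finset.sum_congr rfl fun s hs => ?_
      have := Finset.mem_range.1 hs
      rw [show t + 1 - 1 - s = (t - 1 - s) + 1 by omega]
      ring
    · simp
  have key : (1 - θ) * ∑ t ∈ Finset.range T, S t + S T = ∑ s ∈ Finset.range T, a s := by
    induction T with
    | zero => simp [hS]
    | succ T ih => rw [Finset.sum_range_succ, Finset.sum_range_succ, hstep, ← ih]; ring
  have hST : 0 ≤ S T := Finset.sum_nonneg fun s _ => mul_nonneg (pow_nonneg h0 _) (ha s)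
  rw [le_div_iff₀ (by linarith)]
  linarith

/-! ### Sampled subgradients -/

section Sampling

variable {Ω : Type*} {m mΩ : MeasurableSpace Ω} {P : Measure Ω} [IsProbabilityMeasure P]
  {E : Type*} [NormedAddCommGroup E] [NormedSpace ℝ E]

theorem integral_norm_sq_sub_le {h : Ω → ℝ} (hm : m ≤ mΩ) {ν : ℝ}
    (hvar : P[h | m] ≤ᵐ[P] fun _ => ν ^ 2) : ∫ ω, h ω ∂P ≤ ν ^ 2 := by
  rw [← integral_condExp hm]
  refine (integral_mono_ae integrable_condExp (integrable_const _) hvar).trans ?_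
  simp

/-- Both moments come from pointwise Young inequalities that are sharp when `‖g - ĝ‖ = ν` and `‖ĝ‖ =
L + ν` respectively, so that integrating them loses nothing in the constants. -/
theorem sampling_moments {g ghat : Ω → StrongDual ℝ E} (hm : m ≤ mΩ) {L ν : ℝ} (hL : 0 < L)
    (hν : 0 < ν) (hgL : ∀ᵐ ω ∂P, ‖g ω‖ ≤ L) (hint : Integrable ghat P)
    (hsq : Integrable (fun ω => ‖g ω - ghat ω‖ ^ 2) P)
    (hvar : P[fun ω => ‖g ω - ghat ω‖ ^ 2 | m] ≤ᵐ[P] fun _ => ν ^ 2) :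
    Integrable (fun ω => ‖ghat ω‖ ^ 2) P ∧ ∫ ω, ‖ghat ω‖ ^ 2 ∂P ≤ (L + ν) ^ 2 ∧
      ∫ ω, ‖ghat ω‖ ∂P ≤ L + ν := by
  have hv := integral_norm_sq_sub_le hm hvar
  have hnorm : ∀ ω, ‖g ω‖ ≤ L → ‖ghat ω‖ ≤ L + ‖g ω - ghat ω‖ := fun ω h => by
    have : ghat ω = g ω - (g ω - ghat ω) := by abel
    calc ‖ghat ω‖ = ‖g ω - (g ω - ghat ω)‖ := by rw [← this]
      _ ≤ ‖g ω‖ + ‖g ω - ghat ω‖ := norm_sub_le _ _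
      _ ≤ _ := by linarith
  have hb2 : ∀ᵐ ω ∂P, ‖ghat ω‖ ^ 2 ≤ L * (L + ν) + (1 + L / ν) * ‖g ω - ghat ω‖ ^ 2 := by
    filter_upwards [hgL] with ω h
    have h1 := hnorm ω h
    set r := ‖g ω - ghat ω‖
    have h2 : 2 * L * r ≤ L * ν + L / ν * r ^ 2 := by
      have : L * ν + L / ν * r ^ 2 - 2 * L * r = L / ν * (ν - r) ^ 2 := by field_simp; ring
      have : 0 ≤ L / ν * (ν - r) ^ 2 := by positivity
      linarith
    have h3 : ‖ghat ω‖ ^ 2 ≤ (L + r) ^ 2 := by gcongr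
    linarith
  have hi : Integrable (fun ω => L * (L + ν) + (1 + L / ν) * ‖g ω - ghat ω‖ ^ 2) P :=
    (integrable_const _).add (hsq.const_mul _)
  have hi2 : Integrable (fun ω => ‖ghat ω‖ ^ 2) P := by
    refine hi.mono' (hint.aestronglyMeasurable.norm.pow 2) ?_
    filter_upwards [hb2] with ω h
    rwa [Real.norm_of_nonneg (by positivity)]
  have hsqle : ∫ ω, ‖ghat ω‖ ^ 2 ∂P ≤ (L + ν) ^ 2 := by
    refine (integral_mono_ae hi2 hi hb2).trans ?_
    rw [integral_add (integrable_const _) (hsq.const_mul _), integral_const, integral_const_mul,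
      probReal_univ, one_smul]
    have : (1 + L / ν) * ∫ ω, ‖g ω - ghat ω‖ ^ 2 ∂P ≤ (1 + L / ν) * ν ^ 2 := by gcongr
    have h2 : (1 + L / ν) * ν ^ 2 = ν ^ 2 + L * ν := by field_simp
    linarith
  refine ⟨hi2, hsqle, ?_⟩
  have hc : 0 < L + ν := by linarith
  have hpt : ∀ ω, ‖ghat ω‖ ≤ (L + ν) / 2 + 1 / (2 * (L + ν)) * ‖ghat ω‖ ^ 2 := fun ω => by
    have : (L + ν) / 2 + 1 / (2 * (L + ν)) * ‖ghat ω‖ ^ 2 - ‖ghat ω‖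
        = 1 / (2 * (L + ν)) * (L + ν - ‖ghat ω‖) ^ 2 := by field_simp; ring
    have : 0 ≤ 1 / (2 * (L + ν)) * (L + ν - ‖ghat ω‖) ^ 2 := by positivity
    linarith
  refine (integral_mono hint.norm ((integrable_const _).add (hi2.const_mul _)) hpt).trans ?_
  simp only [Pi.add_apply]
  rw [integral_add (integrable_const _) (hi2.const_mul _), integral_const_mul]
  simp only [integral_const, probReal_univ, one_smul]
  have h1 : 1 / (2 * (L + ν)) * ∫ ω, ‖ghat ω‖ ^ 2 ∂P ≤ 1 / (2 * (L + ν)) * (L + ν) ^ 2 := by gcongr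
  have h2 : 1 / (2 * (L + ν)) * (L + ν) ^ 2 = (L + ν) / 2 := by field_simp
  linarith

omit [IsProbabilityMeasure P] in
theorem integrable_apply {g : Ω → StrongDual ℝ E} {v : Ω → E} (hg : Integrable g P)
    (hv : AEStronglyMeasurable v P) {C : ℝ} (hC : ∀ ω, ‖v ω‖ ≤ C) :
    Integrable (fun ω => g ω (v ω)) P :=
  (ContinuousLinearMap.id ℝ (StrongDual ℝ E)).integrable_of_bilin_of_bdd_right C hg hv
    (ae_of_all _ hC)

/-- An unbiased sample of `g` may replace `g` when it is paired with a vector known before. -/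
theorem integral_apply_eq [FiniteDimensional ℝ E] {g ghat : Ω → StrongDual ℝ E} {v : Ω → E}
    (hm : m ≤ mΩ) (hint : Integrable ghat P) (hun : P[ghat | m] =ᵐ[P] g)
    (hv : StronglyMeasurable[m] v) {C : ℝ} (hC : ∀ ω, ‖v ω‖ ≤ C) :
    ∫ ω, ghat ω (v ω) ∂P = ∫ ω, g ω (v ω) ∂P := by
  have hI := integrable_apply hint (hv.mono hm).aestronglyMeasurable hC
  have h1 := condExp_bilin_of_stronglyMeasurable_right
    (ContinuousLinearMap.id ℝ (StrongDual ℝ E)) hv hI hint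
  rw [← integral_condExp hm]
  refine integral_congr_ae ?_
  filter_upwards [h1, hun] with ω h1 h2
  rw [← h2]
  exact h1

end Sampling

/-! ### The run of one network -/

/-- The assumptions on the run of one network: `Y` holds the strategies of the other network. -/
structure NetworkRun {Ω Z E F : Type*} [MeasurableSpace Ω] (P : Measure Ω)
    [NormedAddCommGroup E] [NormedSpace ℝ E] [MeasurableSpace E]
    [NormedAddCommGroup F] [NormedSpace ℝ F] {n : ℕ}
    (X O : Set E) (Y : Set F) (ψ : E → ℝ) (R : ℝ) (α : ℕ → ℝ)
    (φ : Fin n → E → F → Z → ℝ) (f : Fin n → E → F → ℝ) (L ν η : ℝ) (B : ℕ)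
    (G : ℕ → Digraph (Fin n)) (W : ℕ → Matrix (Fin n) (Fin n) ℝ)
    (ℱ : ℕ → MeasurableSpace Ω) (ξ : Fin n → ℕ → Ω → Z)
    (v : Fin n → ℕ → Ω → E) (u : Fin n → ℕ → Ω → F)
    (g ghat : Fin n → ℕ → Ω → StrongDual ℝ E) (x : Fin n → ℕ → Ω → E) : Prop where
  n_pos : 0 < n
  η_mem : 0 < η ∧ η < 1
  L_pos : 0 < L
  ν_pos : 0 < ν
  step_nonneg : ∀ t, 0 ≤ α t
  step_antitone : Antitone α
  nonempty : X.Nonempty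
  compact : IsCompact X
  convex : Convex ℝ X
  isOpen : IsOpen O
  subset : X ⊆ O
  regularizer : IsRegularizer X ψ
  diam : IsBregmanDiam X ψ R
  bregman_convex : ∀ z ∈ X, ConvexOn ℝ X (fun y => bregman ψ z y)
  lipschitz : ∀ i, IsLipschitzCost O Y L (f i)
  mixing : IsMixing G W η B
  v_eq : v = fun i t => mix (W t i) x t
  u_mem : ∀ i t ω, u i t ω ∈ Y
  ℱ_mono : Monotone ℱ
  ℱ_le : ∀ t, ℱ t ≤ ‹MeasurableSpace Ω›
  init_measurable : ∀ i, Measurable[ℱ 0] (x i 0)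
  run : IsRun X O ψ α φ ℱ ξ v u ghat x
  sampling : UnbiasedSampling P O f ν ℱ v u g ghat

/-- A bound for the distance of the estimates of a network to their average. -/
noncomputable def disagreement {Ω E : Type*} [NormedAddCommGroup E] {n : ℕ} (η : ℝ) (B : ℕ)
    (x v : Fin n → ℕ → Ω → E) (t : ℕ) (ω : Ω) : ℝ :=
  Gam η n * theta η n B ^ t * ∑ j, ‖x j 0 ω‖
    + ∑ s ∈ Finset.range t, Gam η n * theta η n B ^ (t - 1 - s) *
        ∑ j, ‖x j (s + 1) ω - v j s ω‖

namespace NetworkRun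

variable {Ω Z E F : Type*} [mΩ : MeasurableSpace Ω] {P : Measure Ω} [IsProbabilityMeasure P]
  [NormedAddCommGroup E] [NormedSpace ℝ E] [FiniteDimensional ℝ E] [MeasurableSpace E]
  [BorelSpace E] [NormedAddCommGroup F] [NormedSpace ℝ F] {n : ℕ}
  {X O : Set E} {Y : Set F} {ψ : E → ℝ} {R : ℝ} {α : ℕ → ℝ}
  {φ : Fin n → E → F → Z → ℝ} {f : Fin n → E → F → ℝ} {L ν η : ℝ} {B : ℕ}
  {G : ℕ → Digraph (Fin n)} {W : ℕ → Matrix (Fin n) (Fin n) ℝ}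
  {ℱ : ℕ → MeasurableSpace Ω} {ξ : Fin n → ℕ → Ω → Z}
  {v : Fin n → ℕ → Ω → E} {u : Fin n → ℕ → Ω → F}
  {g ghat : Fin n → ℕ → Ω → StrongDual ℝ E} {x : Fin n → ℕ → Ω → E}

section Deterministic

omit [IsProbabilityMeasure P] [FiniteDimensional ℝ E] [BorelSpace E]

theorem mem (h : NetworkRun P X O Y ψ R α φ f L ν η B G W ℱ ξ v u g ghat x) (i : Fin n) (t : ℕ)
    (ω : Ω) : x i t ω ∈ X := by
  cases t with
  | zero => exact h.run.init_mem i ω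
  | succ t => exact (h.run.update i t ω).1

theorem v_mem (h : NetworkRun P X O Y ψ R α φ f L ν η B G W ℱ ξ v u g ghat x) (i : Fin n) (t : ℕ)
    (ω : Ω) : v i t ω ∈ X := by
  rw [h.v_eq]
  exact mix_mem h.convex (h.mixing.nonneg h.η_mem.1 t i) (h.mixing.row_sum t i) fun j => h.mem j t ω

theorem norm_sub_avg_le (h : NetworkRun P X O Y ψ R α φ f L ν η B G W ℱ ξ v u g ghat x) (i : Fin n)
    (t : ℕ) (ω : Ω) : ‖x i t ω - avg (fun j => x j t ω)‖ ≤ disagreement η B x v t ω :=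
  h.mixing.norm_sub_avg_le h.η_mem h.n_pos (fun t i => x i t ω)
    (fun t i => x i (t + 1) ω - v i t ω)
    (fun t i => by
      have : ∑ j, W t i j • x j t ω = v i t ω := by rw [h.v_eq]; rfl
      rw [this]; abel) t i

theorem norm_v_sub_avg_le (h : NetworkRun P X O Y ψ R α φ f L ν η B G W ℱ ξ v u g ghat x)
    (i : Fin n) (t : ℕ) (ω : Ω) :
    ‖v i t ω - avg (fun j => x j t ω)‖ ≤ disagreement η B x v t ω := by
  rw [h.v_eq]
  refine (norm_mix_sub_le (h.mixing.nonneg h.η_mem.1 t i) (h.mixing.row_sum t i) fun j => ?_)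
  exact (h.norm_sub_avg_le j t ω).trans_eq (by rw [h.v_eq])

/-- Convexity of `D(z, ·)` bounds each divergence by the row average, and unit column sums restore
the total: mixing does not increase the potential. -/
theorem sum_bregman_v_le (h : NetworkRun P X O Y ψ R α φ f L ν η B G W ℱ ξ v u g ghat x)
    (t : ℕ) (ω : Ω) {z : E} (hz : z ∈ X) :
    ∑ i, bregman ψ z (v i t ω) ≤ ∑ j, bregman ψ z (x j t ω) := by
  have h1 : ∀ i, bregman ψ z (v i t ω) ≤ ∑ j, W t i j * bregman ψ z (x j t ω) := by
    intro i
    rw [h.v_eq]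
    exact (h.bregman_convex z hz).map_sum_le (fun j _ => h.mixing.nonneg h.η_mem.1 t i j)
      (h.mixing.row_sum t i) (fun j _ => h.mem j t ω)
  refine (Finset.sum_le_sum fun i _ => h1 i).trans_eq ?_
  rw [Finset.sum_comm]
  simp only [← Finset.sum_mul, h.mixing.col_sum, one_mul]

/-- The regret of the sampled subgradients. -/
theorem sum_step_mul_le (h : NetworkRun P X O Y ψ R α φ f L ν η B G W ℱ ξ v u g ghat x)
    {z : E} (hz : z ∈ X) (T : ℕ) (ω : Ω) :
    ∑ t ∈ Finset.range T, α t * ∑ i, ghat i t ω (v i t ω - z)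
      ≤ n * R ^ 2 + ∑ t ∈ Finset.range T, α t ^ 2 / 2 * ∑ i, ‖ghat i t ω‖ ^ 2 := by
  -- The potential `∑ⱼ D(z, xⱼ(t))` telescopes: mixing leads from `x(t)` to `v(t)`, the prox step
  -- from `v(t)` to `x(t + 1)`.
  have key : ∑ t ∈ Finset.range T, α t * ∑ i, ghat i t ω (v i t ω - z)
      ≤ ∑ j, bregman ψ z (x j 0 ω) - ∑ j, bregman ψ z (x j T ω)
        + ∑ t ∈ Finset.range T, α t ^ 2 / 2 * ∑ i, ‖ghat i t ω‖ ^ 2 := by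
    induction T with
    | zero => simp
    | succ T ih =>
      rw [Finset.sum_range_succ, Finset.sum_range_succ]
      have h1 : α T * ∑ i, ghat i T ω (v i T ω - z) ≤ ∑ i, bregman ψ z (v i T ω)
          - ∑ i, bregman ψ z (x i (T + 1) ω) + α T ^ 2 / 2 * ∑ i, ‖ghat i T ω‖ ^ 2 := by
        rw [Finset.mul_sum, Finset.mul_sum, ← Finset.sum_sub_distrib, ← Finset.sum_add_distrib]
        exact Finset.sum_le_sum fun i _ =>
          (h.run.update i T ω).mul_apply_sub_le h.regularizer (h.v_mem i T ω) hz
      have h2 := h.sum_bregman_v_le T ω hz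
      linarith
  have h0 : ∑ j, bregman ψ z (x j 0 ω) ≤ n * R ^ 2 := by
    calc ∑ j, bregman ψ z (x j 0 ω) ≤ ∑ _j : Fin n, R ^ 2 :=
          Finset.sum_le_sum fun j _ => h.diam.2 ⟨z, hz, _, h.mem j 0 ω, rfl⟩
      _ = _ := by simp
  have hT : 0 ≤ ∑ j, bregman ψ z (x j T ω) :=
    Finset.sum_nonneg fun j _ => h.regularizer.bregman_nonneg hz (h.mem j T ω)
  linarith

theorem exists_bound (h : NetworkRun P X O Y ψ R α φ f L ν η B G W ℱ ξ v u g ghat x) :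
    ∃ C : ℝ, ∀ z ∈ X, ‖z‖ ≤ C := h.compact.isBounded.exists_norm_le

theorem norm_g_le (h : NetworkRun P X O Y ψ R α φ f L ν η B G W ℱ ξ v u g ghat x) (i : Fin n)
    (t : ℕ) : ∀ᵐ ω ∂P, ‖g i t ω‖ ≤ L := by
  filter_upwards [h.sampling.subgradient i t] with ω hω
  have hvO := h.subset (h.v_mem i t ω)
  refine norm_le_of_mem_subdiff h.isOpen hvO h.L_pos.le (fun y hy => ?_) hω
  have := h.lipschitz i y hy _ hvO _ (h.u_mem i t ω) _ (h.u_mem i t ω)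
  rw [sub_self, norm_zero, add_zero] at this
  exact (le_abs_self _).trans this

theorem norm_step_le (h : NetworkRun P X O Y ψ R α φ f L ν η B G W ℱ ξ v u g ghat x) (i : Fin n)
    (t : ℕ) (ω : Ω) : ‖x i (t + 1) ω - v i t ω‖ ≤ α t * ‖ghat i t ω‖ := by
  refine ((h.run.update i t ω).norm_sub_le h.regularizer (h.v_mem i t ω)).trans_eq ?_
  rw [norm_neg, norm_smul, Real.norm_of_nonneg (h.step_nonneg t)]

end Deterministic

omit [IsProbabilityMeasure P] in
theorem measurable_state (h : NetworkRun P X O Y ψ R α φ f L ν η B G W ℱ ξ v u g ghat x) (t : ℕ)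
    (i : Fin n) : Measurable[ℱ t] (x i t) := by
  induction t generalizing i with
  | zero => exact h.init_measurable i
  | succ t ih =>
    have hle := h.ℱ_mono (Nat.le_succ t)
    have hv : Measurable[ℱ (t + 1)] (v i t) := by
      rw [h.v_eq]
      exact measurable_mix (m := ℱ (t + 1)) _ fun j => (ih j).mono hle le_rfl
    exact IsProx.measurable (m := ℱ (t + 1)) ⟨h.nonempty, h.compact⟩ h.regularizer hv
      ((h.run.sampled_measurable i t).const_smul (α t)).neg (h.run.update i t)

omit [IsProbabilityMeasure P] in
theorem measurable_v (h : NetworkRun P X O Y ψ R α φ f L ν η B G W ℱ ξ v u g ghat x) (t : ℕ)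
    (i : Fin n) : Measurable[ℱ t] (v i t) := by
  rw [h.v_eq]
  exact measurable_mix (m := ℱ t) _ fun j => h.measurable_state t j

omit [FiniteDimensional ℝ E] [BorelSpace E] in
theorem moments (h : NetworkRun P X O Y ψ R α φ f L ν η B G W ℱ ξ v u g ghat x) (i : Fin n)
    (t : ℕ) : Integrable (fun ω => ‖ghat i t ω‖ ^ 2) P ∧
      ∫ ω, ‖ghat i t ω‖ ^ 2 ∂P ≤ (L + ν) ^ 2 ∧ ∫ ω, ‖ghat i t ω‖ ∂P ≤ L + ν :=
  sampling_moments (h.ℱ_le t) h.L_pos h.ν_pos (h.norm_g_le i t) (h.sampling.integrable i t)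
    (h.sampling.sq_integrable i t) (h.sampling.variance_le i t)

/-- The vector `v i t - z` is known at time `t` and bounded because `X` is compact, so it may be
taken out of the conditional expectation. -/
theorem integral_g_eq (h : NetworkRun P X O Y ψ R α φ f L ν η B G W ℱ ξ v u g ghat x) (i : Fin n)
    (t : ℕ) (z : E) :
    Integrable (fun ω => ghat i t ω (v i t ω - z)) P ∧
    Integrable (fun ω => g i t ω (v i t ω - z)) P ∧
      ∫ ω, ghat i t ω (v i t ω - z) ∂P = ∫ ω, g i t ω (v i t ω - z) ∂P := by
  have : ProperSpace E := FiniteDimensional.proper_real E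
  obtain ⟨C, hC⟩ := h.exists_bound
  have hb : ∀ ω, ‖v i t ω - z‖ ≤ C + ‖z‖ := fun ω =>
    (norm_sub_le _ _).trans (by gcongr; exact hC _ (h.v_mem i t ω))
  have hm : StronglyMeasurable[ℱ t] (fun ω => v i t ω - z) :=
    ((h.measurable_v t i).sub_const z).stronglyMeasurable
  have hm' := (hm.mono (h.ℱ_le t)).aestronglyMeasurable (μ := P)
  have hg : Integrable (g i t) P := integrable_condExp.congr (h.sampling.unbiased i t)
  exact ⟨integrable_apply (h.sampling.integrable i t) hm' hb, integrable_apply hg hm' hb,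
    integral_apply_eq (h.ℱ_le t) (h.sampling.integrable i t) (h.sampling.unbiased i t) hm hb⟩

/-- The regret of the subgradients in expectation. -/
theorem sum_step_mul_integral_le (h : NetworkRun P X O Y ψ R α φ f L ν η B G W ℱ ξ v u g ghat x)
    {z : E} (hz : z ∈ X) (T : ℕ) :
    ∑ t ∈ Finset.range T, α t * ∫ ω, 1 / (n : ℝ) * ∑ i, g i t ω (v i t ω - z) ∂P
      ≤ R ^ 2 + (L + ν) ^ 2 / 2 * ∑ t ∈ Finset.range T, α t ^ 2 := by
  have hn : (0 : ℝ) < n := by exact_mod_cast h.n_pos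
  have hI := fun i t => h.integral_g_eq i t z
  have hM := h.moments
  have h1 : ∑ t ∈ Finset.range T, α t * ∫ ω, 1 / (n : ℝ) * ∑ i, g i t ω (v i t ω - z) ∂P
      = 1 / n * ∫ ω, ∑ t ∈ Finset.range T, α t * ∑ i, ghat i t ω (v i t ω - z) ∂P := by
    rw [integral_finsetSum _ fun t _ =>
      (integrable_finsetSum _ fun i _ => (hI i t).1).const_mul _, Finset.mul_sum]
    refine Finset.sum_congr rfl fun t _ => ?_
    rw [integral_const_mul, integral_const_mul, integral_finsetSum _ fun i _ => (hI i t).2.1,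
      integral_finsetSum _ fun i _ => (hI i t).1]
    simp only [(hI _ t).2.2]
    ring
  have h2 : ∫ ω, ∑ t ∈ Finset.range T, α t * ∑ i, ghat i t ω (v i t ω - z) ∂P
      ≤ ∫ ω, (n * R ^ 2 + ∑ t ∈ Finset.range T, α t ^ 2 / 2 * ∑ i, ‖ghat i t ω‖ ^ 2) ∂P := by
    refine integral_mono (integrable_finsetSum _ fun t _ =>
      (integrable_finsetSum _ fun i _ => (hI i t).1).const_mul _)
      ((integrable_const _).add (integrable_finsetSum _ fun t _ =>
      (integrable_finsetSum _ fun i _ => (hM i t).1).const_mul _)) fun ω => ?_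
    exact h.sum_step_mul_le hz T ω
  have h3 : ∫ ω, (n * R ^ 2 + ∑ t ∈ Finset.range T, α t ^ 2 / 2 * ∑ i, ‖ghat i t ω‖ ^ 2) ∂P
      ≤ n * R ^ 2 + ∑ t ∈ Finset.range T, α t ^ 2 / 2 * (n * (L + ν) ^ 2) := by
    rw [integral_add (integrable_const _) (integrable_finsetSum _ fun t _ =>
      (integrable_finsetSum _ fun i _ => (hM i t).1).const_mul _),
      integral_finsetSum _ fun t _ =>
      (integrable_finsetSum _ fun i _ => (hM i t).1).const_mul _]
    simp only [integral_const, probReal_univ, one_smul]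
    gcongr with t _
    rw [integral_const_mul, integral_finsetSum _ fun i _ => (hM i t).1]
    gcongr
    calc ∑ i, ∫ ω, ‖ghat i t ω‖ ^ 2 ∂P ≤ ∑ _i : Fin n, (L + ν) ^ 2 :=
          Finset.sum_le_sum fun i _ => (hM i t).2.1
      _ = _ := by simp
  rw [h1]
  calc 1 / (n : ℝ) * ∫ ω, ∑ t ∈ Finset.range T, α t * ∑ i, ghat i t ω (v i t ω - z) ∂P
      ≤ 1 / n * (n * R ^ 2 + ∑ t ∈ Finset.range T, α t ^ 2 / 2 * (n * (L + ν) ^ 2)) := by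
        gcongr; exact h2.trans h3
    _ = _ := by
        rw [← Finset.sum_mul, ← Finset.sum_div]
        field_simp

theorem integrable_norm_init (h : NetworkRun P X O Y ψ R α φ f L ν η B G W ℱ ξ v u g ghat x)
    (i : Fin n) : Integrable (fun ω => ‖x i 0 ω‖) P := by
  obtain ⟨C, hC⟩ := h.exists_bound
  refine Integrable.of_bound (C := C) ?_ (ae_of_all _ fun ω => ?_)
  · exact ((h.measurable_state 0 i).mono (h.ℱ_le 0) le_rfl).norm.aestronglyMeasurable
  · rw [norm_norm]; exact hC _ (h.mem i 0 ω)

theorem integral_sum_norm_init_le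
    (h : NetworkRun P X O Y ψ R α φ f L ν η B G W ℱ ξ v u g ghat x) :
    ∫ ω, ∑ j, ‖x j 0 ω‖ ∂P ≤ n * Lam P x := by
  obtain ⟨C, hC⟩ := h.exists_bound
  have : Nonempty (Fin n) := ⟨⟨0, h.n_pos⟩⟩
  have hle : ∀ ω j, ‖x j 0 ω‖ ≤ ⨆ i, ‖x i 0 ω‖ := fun ω j =>
    le_ciSup (f := fun i => ‖x i 0 ω‖) (Set.finite_range _).bddAbove j
  have hint : Integrable (fun ω => ⨆ i, ‖x i 0 ω‖) P := by
    refine Integrable.of_bound (C := C) ?_ (ae_of_all _ fun ω => ?_)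
    · exact (Measurable.iSup fun i =>
        ((h.measurable_state 0 i).mono (h.ℱ_le 0) le_rfl).norm).aestronglyMeasurable
    · rw [Real.norm_of_nonneg (Real.iSup_nonneg fun i => norm_nonneg _)]
      exact ciSup_le fun i => hC _ (h.mem i 0 ω)
  rw [integral_finsetSum _ fun j _ => h.integrable_norm_init j]
  calc ∑ j, ∫ ω, ‖x j 0 ω‖ ∂P ≤ ∑ _j : Fin n, Lam P x :=
        Finset.sum_le_sum fun j _ =>
          integral_mono (h.integrable_norm_init j) hint fun ω => hle ω j
    _ = _ := by simp

omit [IsProbabilityMeasure P] in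
theorem integrable_norm_step (h : NetworkRun P X O Y ψ R α φ f L ν η B G W ℱ ξ v u g ghat x)
    (i : Fin n) (t : ℕ) : Integrable (fun ω => ‖x i (t + 1) ω - v i t ω‖) P := by
  have : ProperSpace E := FiniteDimensional.proper_real E
  refine ((h.sampling.integrable i t).norm.const_mul (α t)).mono' ?_ (ae_of_all _ fun ω => ?_)
  · exact (((h.measurable_state (t + 1) i).mono (h.ℱ_le _) le_rfl).sub
      ((h.measurable_v t i).mono (h.ℱ_le _) le_rfl)).norm.aestronglyMeasurable
  · rw [norm_norm]; exact h.norm_step_le i t ω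

theorem integral_sum_norm_step_le
    (h : NetworkRun P X O Y ψ R α φ f L ν η B G W ℱ ξ v u g ghat x) (t : ℕ) :
    ∫ ω, ∑ j, ‖x j (t + 1) ω - v j t ω‖ ∂P ≤ n * ((L + ν) * α t) := by
  rw [integral_finsetSum _ fun j _ => h.integrable_norm_step j t]
  calc ∑ j, ∫ ω, ‖x j (t + 1) ω - v j t ω‖ ∂P ≤ ∑ _j : Fin n, (L + ν) * α t := by
        refine Finset.sum_le_sum fun j _ => ?_
        refine (integral_mono (h.integrable_norm_step j t)
          ((h.sampling.integrable j t).norm.const_mul (α t)) (h.norm_step_le j t)).trans ?_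
        rw [integral_const_mul, mul_comm]
        exact mul_le_mul_of_nonneg_right (h.moments j t).2.2 (h.step_nonneg t)
    _ = _ := by simp

theorem integrable_disagreement (h : NetworkRun P X O Y ψ R α φ f L ν η B G W ℱ ξ v u g ghat x)
    (t : ℕ) : Integrable (disagreement η B x v t) P :=
  ((integrable_finsetSum _ fun j _ => h.integrable_norm_init j).const_mul _).add
    (integrable_finsetSum _ fun s _ =>
      (integrable_finsetSum _ fun j _ => h.integrable_norm_step j s).const_mul _)

/-- Monotone step sizes decouple the sums: `α t ≤ α 0` in the initial term, and `α t ≤ α s` for `s <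
t` turns `α t * α s` into `α s ^ 2`. Geometric series then give the factors `1 / (1 - θ)`. -/
theorem sum_step_mul_disagreement_le
    (h : NetworkRun P X O Y ψ R α φ f L ν η B G W ℱ ξ v u g ghat x) (T : ℕ) :
    ∑ t ∈ Finset.range T, α t * ∫ ω, disagreement η B x v t ω ∂P
      ≤ n * Gam η n * Lam P x * α 0 / (1 - theta η n B)
        + n * Gam η n * (L + ν) / (1 - theta η n B) * ∑ t ∈ Finset.range T, α t ^ 2 := by
  have hΓ := Gam_pos (n := n) h.η_mem h.n_pos
  have hθ0 := theta_pos (B := B) (n := n) h.η_mem h.n_pos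
  have hθ1 := theta_lt_one (n := n) h.η_mem h.n_pos h.mixing.one_le_window
  set Γ := Gam η n
  set θ := theta η n B
  have hLν : 0 < L + ν := add_pos h.L_pos h.ν_pos
  have hΛ : 0 ≤ Lam P x :=
    integral_nonneg fun ω => Real.iSup_nonneg fun i => norm_nonneg _
  have h1 : ∀ t, ∫ ω, disagreement η B x v t ω ∂P ≤ Γ * θ ^ t * (n * Lam P x)
      + ∑ s ∈ Finset.range t, Γ * θ ^ (t - 1 - s) * (n * ((L + ν) * α s)) := by
    intro t
    unfold disagreement
    rw [integral_add ((integrable_finsetSum _ fun j _ => h.integrable_norm_init j).const_mul _)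
      (integrable_finsetSum _ fun s _ =>
      (integrable_finsetSum _ fun j _ => h.integrable_norm_step j s).const_mul _),
      integral_const_mul, integral_finsetSum _ fun s _ =>
      (integrable_finsetSum _ fun j _ => h.integrable_norm_step j s).const_mul _]
    gcongr with s _
    · exact h.integral_sum_norm_init_le
    · rw [integral_const_mul]
      gcongr
      exact h.integral_sum_norm_step_le s
  have h2 : ∀ t, α t * ∫ ω, disagreement η B x v t ω ∂P
      ≤ n * Γ * Lam P x * α 0 * θ ^ t
        + n * Γ * (L + ν) * ∑ s ∈ Finset.range t, θ ^ (t - 1 - s) * α s ^ 2 := by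
    intro t
    refine (mul_le_mul_of_nonneg_left (h1 t) (h.step_nonneg t)).trans ?_
    rw [mul_add, Finset.mul_sum, Finset.mul_sum]
    refine add_le_add ?_ (Finset.sum_le_sum fun s hs => ?_)
    · calc α t * (Γ * θ ^ t * (n * Lam P x)) ≤ α 0 * (Γ * θ ^ t * (n * Lam P x)) := by
            gcongr; exact h.step_antitone (Nat.zero_le t)
        _ = _ := by ring
    · have := h.step_nonneg s
      calc α t * (Γ * θ ^ (t - 1 - s) * (n * ((L + ν) * α s)))
          ≤ α s * (Γ * θ ^ (t - 1 - s) * (n * ((L + ν) * α s))) := by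
            gcongr; exact h.step_antitone (Finset.mem_range.1 hs).le
        _ = _ := by ring
  refine (Finset.sum_le_sum fun t _ => h2 t).trans ?_
  rw [Finset.sum_add_distrib, ← Finset.mul_sum, ← Finset.mul_sum]
  have h0 := h.step_nonneg 0
  have h3 : n * Γ * Lam P x * α 0 * ∑ t ∈ Finset.range T, θ ^ t
      ≤ n * Γ * Lam P x * α 0 * (1 / (1 - θ)) := by
    gcongr; exact geom_sum_le hθ0.le hθ1 T
  have h4 : n * Γ * (L + ν) * ∑ t ∈ Finset.range T, ∑ s ∈ Finset.range t, θ ^ (t - 1 - s) * α s ^ 2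
      ≤ n * Γ * (L + ν) * ((∑ s ∈ Finset.range T, α s ^ 2) / (1 - θ)) := by
    gcongr; exact sum_sum_geom_le hθ0.le hθ1 (fun t => sq_nonneg _) T
  refine (add_le_add h3 h4).trans_eq ?_
  ring

theorem integrable_sq_dist (h : NetworkRun P X O Y ψ R α φ f L ν η B G W ℱ ξ v u g ghat x)
    (i : Fin n) (t : ℕ) (y : E) : Integrable (fun ω => ‖x i t ω - y‖ ^ 2) P := by
  have : ProperSpace E := FiniteDimensional.proper_real E
  obtain ⟨C, hC⟩ := h.exists_bound
  refine Integrable.of_bound (C := (C + ‖y‖) ^ 2) ?_ (ae_of_all _ fun ω => ?_)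
  · exact ((((h.measurable_state t i).mono (h.ℱ_le t) le_rfl).sub_const y).norm.pow_const
      2).aestronglyMeasurable
  · rw [Real.norm_of_nonneg (by positivity)]
    gcongr
    exact (norm_sub_le _ _).trans (by gcongr; exact hC _ (h.mem i t ω))

end NetworkRun

/-! ### Nash equilibria -/

section Nash

variable {E₁ E₂ : Type*} [NormedAddCommGroup E₁] [NormedSpace ℝ E₁] [NormedAddCommGroup E₂]
  [NormedSpace ℝ E₂] {X₁ : Set E₁} {X₂ : Set E₂} {U : E₁ → E₂ → ℝ} {μ : ℝ}

/-- The gap function of a strongly convex-concave game dominates the squared distance to a NE. -/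
theorem IsNash.growth (hU : IsStronglyConvexConcave X₁ X₂ μ U) {y₁ : E₁} {y₂ : E₂}
    (h : IsNash X₁ X₂ U y₁ y₂) {z₁ : E₁} {z₂ : E₂} (hz₁ : z₁ ∈ X₁) (hz₂ : z₂ ∈ X₂) :
    U y₁ y₂ + μ / 2 * ‖z₁ - y₁‖ ^ 2 ≤ U z₁ y₂ ∧ U y₁ z₂ + μ / 2 * ‖z₂ - y₂‖ ^ 2 ≤ U y₁ y₂ := by
  have h1 := add_sq_le_of_strongConvexOn (hU.1 y₂ h.2.1) h.1
    (fun x hx => (h.2.2 x hx y₂ h.2.1).2) hz₁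
  have h2 := add_sq_le_of_strongConvexOn (UniformConcaveOn.neg (hU.2 y₁ h.1)) h.2.1
    (fun x hx => neg_le_neg (h.2.2 y₁ h.1 x hx).1) hz₂
  simp only [Pi.neg_apply] at h2
  exact ⟨h1, by linarith⟩

theorem IsNash.gap_ge (hU : IsStronglyConvexConcave X₁ X₂ μ U) {y₁ : E₁} {y₂ : E₂}
    (h : IsNash X₁ X₂ U y₁ y₂) {z₁ : E₁} {z₂ : E₂} (hz₁ : z₁ ∈ X₁) (hz₂ : z₂ ∈ X₂) :
    μ / 2 * (‖z₁ - y₁‖ ^ 2 + ‖z₂ - y₂‖ ^ 2) ≤ U z₁ y₂ - U y₁ z₂ := by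
  have := h.growth hU hz₁ hz₂
  linarith

/-- If `z` is a NE too, then `U z₁ y₂ ≤ U z₁ z₂ ≤ U y₁ z₂`, so the gap that dominates the squared
distances is not positive. -/
theorem IsNash.unique (hμ : 0 < μ) (hU : IsStronglyConvexConcave X₁ X₂ μ U) {y₁ z₁ : E₁}
    {y₂ z₂ : E₂} (hy : IsNash X₁ X₂ U y₁ y₂) (hz : IsNash X₁ X₂ U z₁ z₂) : z₁ = y₁ ∧ z₂ = y₂ := by
  have h1 := hy.gap_ge hU hz.1 hz.2.1
  have h2 := hz.2.2 y₁ hy.1 y₂ hy.2.1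
  have h3 : ‖z₁ - y₁‖ ^ 2 + ‖z₂ - y₂‖ ^ 2 ≤ 0 := by
    by_contra hc
    have := mul_pos (half_pos hμ) (not_le.1 hc)
    linarith
  have h4 := sq_nonneg ‖z₁ - y₁‖
  have h5 := sq_nonneg ‖z₂ - y₂‖
  constructor
  · have : ‖z₁ - y₁‖ ^ 2 = 0 := by linarith
    exact sub_eq_zero.1 (norm_eq_zero.1 (pow_eq_zero_iff two_ne_zero |>.1 this))
  · have : ‖z₂ - y₂‖ ^ 2 = 0 := by linarith
    exact sub_eq_zero.1 (norm_eq_zero.1 (pow_eq_zero_iff two_ne_zero |>.1 this))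

/-- Sion's theorem applies on compact convex sets: the Lipschitz bound gives the semicontinuity,
strong convexity and concavity give the quasiconvexity and quasiconcavity. -/
theorem exists_isNash {L : ℝ} (hX₁ : X₁.Nonempty ∧ IsCompact X₁ ∧ Convex ℝ X₁)
    (hX₂ : X₂.Nonempty ∧ IsCompact X₂ ∧ Convex ℝ X₂) (hL : 0 < L) (hUL : IsLipschitzCost X₁ X₂ L U)
    (hμ : 0 < μ) (hU : IsStronglyConvexConcave X₁ X₂ μ U) : ∃ y₁ y₂, IsNash X₁ X₂ U y₁ y₂ := by
  have hc₁ : ∀ y ∈ X₂, ContinuousOn (fun x => U x y) X₁ := fun y hy =>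
    (LipschitzOnWith.of_dist_le_mul (K := ⟨L, hL.le⟩) fun x hx x' hx' => by
      have := hUL x hx x' hx' y hy y hy
      rw [sub_self, norm_zero, add_zero] at this
      rwa [Real.dist_eq, dist_eq_norm]).continuousOn
  have hc₂ : ∀ x ∈ X₁, ContinuousOn (fun y => U x y) X₂ := fun x hx =>
    (LipschitzOnWith.of_dist_le_mul (K := ⟨L, hL.le⟩) fun y hy y' hy' => by
      have := hUL x hx x hx y hy y' hy'
      rw [sub_self, norm_zero, zero_add] at this
      rwa [Real.dist_eq, dist_eq_norm]).continuousOn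
  obtain ⟨a, ha, b, hb, hab⟩ := Sion.exists_isSaddlePointOn (f := U) hX₁.1 hX₁.2.2 hX₁.2.1
    (fun y hy => (hc₁ y hy).lowerSemicontinuousOn)
    (fun y hy => ((hU.1 y hy).strictConvexOn hμ).convexOn.quasiconvexOn) hX₂.2.2 hX₂.1 hX₂.2.1
    (fun x hx => (hc₂ x hx).upperSemicontinuousOn)
    (fun x hx => ((hU.2 x hx).strictConcaveOn hμ).concaveOn.quasiconcaveOn)
  exact ⟨a, b, ha, hb, fun x hx y hy => ⟨hab a ha y hy, hab x hx b hb⟩⟩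

end Nash

/-! ### Costs -/

theorem IsLipschitzCost.avg {E F : Type*} [NormedAddCommGroup E] [NormedAddCommGroup F] {n : ℕ}
    (hn : 0 < n) {O : Set E} {Y : Set F} {L : ℝ} {f : Fin n → E → F → ℝ}
    (hf : ∀ i, IsLipschitzCost O Y L (f i)) :
    IsLipschitzCost O Y L (fun x y => 1 / (n : ℝ) * ∑ i, f i x y) := by
  intro x hx x' hx' y hy y' hy'
  have hn' : (0 : ℝ) < n := by exact_mod_cast hn
  rw [← mul_sub, ← Finset.sum_sub_distrib, abs_mul, abs_of_pos (by positivity), one_div,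
    inv_mul_le_iff₀ hn']
  calc |∑ i, (f i x y - f i x' y')| ≤ ∑ i, |f i x y - f i x' y'| := Finset.abs_sum_le_sum_abs _ _
    _ ≤ ∑ _i : Fin n, L * (‖x - x'‖ + ‖y - y'‖) :=
        Finset.sum_le_sum fun i _ => hf i x hx x' hx' y hy y' hy'
    _ = _ := by simp

/-- The linearized regret at nearby points bounds the regret at common points. -/
theorem sub_le_avg_subgradient {E F : Type*} [NormedAddCommGroup E] [NormedSpace ℝ E]
    [NormedAddCommGroup F] {n : ℕ} (hn : 0 < n) {O : Set E} {Y : Set F} {L : ℝ} (hL : 0 < L)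
    {f : Fin n → E → F → ℝ} (hf : ∀ i, IsLipschitzCost O Y L (f i)) {v : Fin n → E} {u : Fin n → F}
    {g : Fin n → StrongDual ℝ E} (hg : ∀ i, g i ∈ subdiff O (fun y => f i y (u i)) (v i))
    (hv : ∀ i, v i ∈ O) (hu : ∀ i, u i ∈ Y) {c z : E} {d : F} (hc : c ∈ O) (hz : z ∈ O) (hd : d ∈ Y)
    {a b : ℝ} (ha : ∀ i, ‖v i - c‖ ≤ a) (hb : ∀ i, ‖u i - d‖ ≤ b) :
    1 / (n : ℝ) * ∑ i, f i c d - 1 / (n : ℝ) * ∑ i, f i z d - L * a - 2 * (L * b)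
      ≤ 1 / (n : ℝ) * ∑ i, g i (v i - z) := by
  have hn' : (0 : ℝ) < n := by exact_mod_cast hn
  -- The subgradient inequality holds at `(v i, u i)`. Passing to `(c, d)` at the base point costs
  -- `L (a + b)`, replacing `u i` by `d` at the comparison point `z` costs another `L b`.
  have key : ∀ i, f i c d - f i z d - (L * a + 2 * (L * b)) ≤ g i (v i - z) := by
    intro i
    have h1 := hg i z hz
    have h2 := (abs_le.1 (hf i (v i) (hv i) c hc (u i) (hu i) d hd)).1
    have h3 := (abs_le.1 (hf i z hz z hz (u i) (hu i) d hd)).2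
    have h4 : L * ‖v i - c‖ ≤ L * a := by gcongr; exact ha i
    have h5 : L * ‖u i - d‖ ≤ L * b := by gcongr; exact hb i
    have h6 : g i (v i - z) = - g i (z - v i) := by rw [← map_neg, neg_sub]
    rw [sub_self, norm_zero, zero_add] at h3
    rw [mul_add] at h2
    linarith
  have hs := Finset.sum_le_sum fun i (_ : i ∈ Finset.univ) => key i
  rw [Finset.sum_sub_distrib, Finset.sum_sub_distrib, Finset.sum_const, Finset.card_univ,
    Fintype.card_fin, nsmul_eq_mul] at hs
  have := mul_le_mul_of_nonneg_left hs (one_div_pos.2 hn').le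
  rw [mul_sub, mul_sub] at this
  have h7 : 1 / (n : ℝ) * (n * (L * a + 2 * (L * b))) = L * a + 2 * (L * b) := by field_simp
  linarith

/-! ### Time averages -/

/-- Jensen's inequality for the squared norm, obtained from the triangle inequality and
Cauchy–Schwarz with weights `α s`. -/
theorem norm_timeAvg_sub_sq_le {Ω E : Type*} [NormedAddCommGroup E] [NormedSpace ℝ E] {α : ℕ → ℝ}
    (hα : ∀ t, 0 ≤ α t) (x : ℕ → Ω → E) (y : E) {t : ℕ} (ht : 0 < ∑ s ∈ Finset.range t, α s)
    (ω : Ω) : ‖timeAvg α x t ω - y‖ ^ 2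
      ≤ (∑ s ∈ Finset.range t, α s)⁻¹ * ∑ s ∈ Finset.range t, α s * ‖x s ω - y‖ ^ 2 := by
  set A := ∑ s ∈ Finset.range t, α s with hA
  have h1 : timeAvg α x t ω - y = A⁻¹ • ∑ s ∈ Finset.range t, α s • (x s ω - y) := by
    simp only [timeAvg, smul_sub, Finset.sum_sub_distrib, ← Finset.sum_smul, ← hA]
    rw [smul_smul, inv_mul_cancel₀ ht.ne', one_smul]
  have h2 : ‖∑ s ∈ Finset.range t, α s • (x s ω - y)‖ ≤ ∑ s ∈ Finset.range t, α s * ‖x s ω - y‖ :=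
    norm_sum_le_of_le _ fun s _ => by rw [norm_smul, Real.norm_of_nonneg (hα s)]
  have h3 : (∑ s ∈ Finset.range t, α s * ‖x s ω - y‖) ^ 2
      ≤ A * ∑ s ∈ Finset.range t, α s * ‖x s ω - y‖ ^ 2 :=
    Finset.sum_sq_le_sum_mul_sum_of_sq_le_mul _ (fun s _ => hα s)
      (fun s _ => mul_nonneg (hα s) (sq_nonneg _)) fun s _ => by ring_nf; exact le_rfl
  rw [h1, norm_smul, mul_pow, Real.norm_of_nonneg (inv_nonneg.2 ht.le)]
  calc A⁻¹ ^ 2 * ‖∑ s ∈ Finset.range t, α s • (x s ω - y)‖ ^ 2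
      ≤ A⁻¹ ^ 2 * (A * ∑ s ∈ Finset.range t, α s * ‖x s ω - y‖ ^ 2) := by
        gcongr; exact (pow_le_pow_left₀ (norm_nonneg _) h2 2).trans h3
    _ = _ := by field_simp

theorem measurable_timeAvg {Ω E : Type*} [MeasurableSpace Ω] [NormedAddCommGroup E]
    [NormedSpace ℝ E] [FiniteDimensional ℝ E] [MeasurableSpace E] [BorelSpace E] {α : ℕ → ℝ}
    {x : ℕ → Ω → E} (hx : ∀ t, Measurable (x t)) (t : ℕ) : Measurable (timeAvg α x t) := by
  have : ProperSpace E := FiniteDimensional.proper_real E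
  unfold timeAvg
  exact (Finset.measurable_fun_sum _ fun s _ => (hx s).const_smul (α s)).const_smul
    (∑ s ∈ Finset.range t, α s)⁻¹

/-! ### Histories -/

section History

variable {Ω Z E₁ E₂ : Type*} [MeasurableSpace Z] [MeasurableSpace E₁] [MeasurableSpace E₂]
  {n₁ n₂ : ℕ} {x₁ : Fin n₁ → ℕ → Ω → E₁} {x₂ : Fin n₂ → ℕ → Ω → E₂}
  {ξ₁ : Fin n₁ → ℕ → Ω → Z} {ξ₂ : Fin n₂ → ℕ → Ω → Z}

theorem history_mono : Monotone (history x₁ x₂ ξ₁ ξ₂) := by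
  intro s t hst
  refine sup_le_sup le_rfl (sup_le_sup ?_ ?_) <;>
  exact iSup_mono fun i => iSup_mono fun r => iSup_mono' fun hr => ⟨lt_of_lt_of_le hr hst, le_rfl⟩

theorem history_le [m : MeasurableSpace Ω] (hx₁ : ∀ i, Measurable (x₁ i 0))
    (hx₂ : ∀ i, Measurable (x₂ i 0)) (hξ₁ : ∀ i t, Measurable (ξ₁ i t))
    (hξ₂ : ∀ i t, Measurable (ξ₂ i t)) (t : ℕ) : history x₁ x₂ ξ₁ ξ₂ t ≤ m :=
  sup_le (sup_le (iSup_le fun i => (hx₁ i).comap_le) (iSup_le fun i => (hx₂ i).comap_le))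
    (sup_le (iSup_le fun i => iSup_le fun s => iSup_le fun _ => (hξ₁ i s).comap_le)
      (iSup_le fun i => iSup_le fun s => iSup_le fun _ => (hξ₂ i s).comap_le))

theorem measurable_history_left (i : Fin n₁) : Measurable[history x₁ x₂ ξ₁ ξ₂ 0] (x₁ i 0) :=
  Measurable.of_comap_le ((le_iSup (fun i => MeasurableSpace.comap (x₁ i 0) inferInstance) i).trans
    (le_sup_left.trans le_sup_left))

theorem measurable_history_right (i : Fin n₂) : Measurable[history x₁ x₂ ξ₁ ξ₂ 0] (x₂ i 0) :=
  Measurable.of_comap_le ((le_iSup (fun i => MeasurableSpace.comap (x₂ i 0) inferInstance) i).trans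
    (le_sup_right.trans le_sup_left))

end History

/-! ### Two networks -/

theorem M2part_nonneg {L ν η : ℝ} {n B : ℕ} (hL : 0 < L) (hν : 0 < ν) (hη : 0 < η ∧ η < 1)
    (hn : 0 < n) (hB : 1 ≤ B) : 0 ≤ M2part L ν η n B := by
  have hΓ := Gam_pos hη hn
  have hθ : 0 < 1 - theta η n B := sub_pos.2 (theta_lt_one hη hn hB)
  unfold M2part
  positivity

/-- The contribution of one network to the bound. -/
theorem regret_add_disagreement_le {L ν η R Λ a Q : ℝ} {n B : ℕ} (hL : 0 < L) (hν : 0 < ν)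
    (hQ : 0 ≤ Q) :
    R ^ 2 + (L + ν) ^ 2 / 2 * Q + 4 * L * (n * Gam η n * Λ * a / (1 - theta η n B)
        + n * Gam η n * (L + ν) / (1 - theta η n B) * Q)
      ≤ M1part L η n B Λ a R + M2part L ν η n B * Q := by
  -- The constants `M₁` and `M₂` are not tight; the slack is exactly the nonnegative right side of
  -- this identity.
  have h : M1part L η n B Λ a R + M2part L ν η n B * Q
      - (R ^ 2 + (L + ν) ^ 2 / 2 * Q + 4 * L * (n * Gam η n * Λ * a / (1 - theta η n B)
        + n * Gam η n * (L + ν) / (1 - theta η n B) * Q))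
      = R ^ 2 + (8 * L * (L + ν) + (L + ν) ^ 2 / 2 + ν ^ 2 / 2) * Q := by
    unfold M1part M2part
    ring
  have : 0 ≤ R ^ 2 + (8 * L * (L + ν) + (L + ν) ^ 2 / 2 + ν ^ 2 / 2) * Q := by positivity
  linarith

section TwoNetworks

variable {Ω Z : Type*} [mΩ : MeasurableSpace Ω] {P : Measure Ω} [IsProbabilityMeasure P]
  {E₁ : Type*} [NormedAddCommGroup E₁] [NormedSpace ℝ E₁] [FiniteDimensional ℝ E₁]
  [MeasurableSpace E₁] [BorelSpace E₁]
  {E₂ : Type*} [NormedAddCommGroup E₂] [NormedSpace ℝ E₂] [FiniteDimensional ℝ E₂]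
  [MeasurableSpace E₂] [BorelSpace E₂]
  {X₁ O₁ : Set E₁} {X₂ O₂ : Set E₂} {ψ₁ : E₁ → ℝ} {ψ₂ : E₂ → ℝ} {R₁ R₂ : ℝ} {α : ℕ → ℝ}
  {n₁ n₂ : ℕ} {φ₁ : Fin n₁ → E₁ → E₂ → Z → ℝ} {φ₂ : Fin n₂ → E₂ → E₁ → Z → ℝ}
  {f₁ : Fin n₁ → E₁ → E₂ → ℝ} {f₂ : Fin n₂ → E₂ → E₁ → ℝ} {L ν₁ ν₂ η : ℝ} {B₁ B₂ : ℕ}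
  {G₁ : ℕ → Digraph (Fin n₁)} {W₁ : ℕ → Matrix (Fin n₁) (Fin n₁) ℝ}
  {G₂ : ℕ → Digraph (Fin n₂)} {W₂ : ℕ → Matrix (Fin n₂) (Fin n₂) ℝ}
  {ℱ : ℕ → MeasurableSpace Ω} {ξ₁ : Fin n₁ → ℕ → Ω → Z} {ξ₂ : Fin n₂ → ℕ → Ω → Z}
  {x₁ v₁ : Fin n₁ → ℕ → Ω → E₁} {u₂ : Fin n₁ → ℕ → Ω → E₂}
  {x₂ v₂ : Fin n₂ → ℕ → Ω → E₂} {u₁ : Fin n₂ → ℕ → Ω → E₁}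
  {g₁ ghat₁ : Fin n₁ → ℕ → Ω → StrongDual ℝ E₁} {g₂ ghat₂ : Fin n₂ → ℕ → Ω → StrongDual ℝ E₂}
  {U : E₁ → E₂ → ℝ} {μ : ℝ} {y₁ : E₁} {y₂ : E₂}

omit [IsProbabilityMeasure P] [FiniteDimensional ℝ E₁] [BorelSpace E₁] [FiniteDimensional ℝ E₂]
  [BorelSpace E₂] in
/-- The squared distance of the estimates to the NE is bounded by the linearized regrets of the
networks and the disagreements. -/
theorem sq_dist_le_regret
    (h₁ : NetworkRun P X₁ O₁ X₂ ψ₁ R₁ α φ₁ f₁ L ν₁ η B₁ G₁ W₁ ℱ ξ₁ v₁ u₂ g₁ ghat₁ x₁)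
    (h₂ : NetworkRun P X₂ O₂ X₁ ψ₂ R₂ α φ₂ f₂ L ν₂ η B₂ G₂ W₂ ℱ ξ₂ v₂ u₁ g₂ ghat₂ x₂)
    (hu₂ : ∀ i t ω, ‖u₂ i t ω - avg (fun j => x₂ j t ω)‖ ≤ disagreement η B₂ x₂ v₂ t ω)
    (hu₁ : ∀ i t ω, ‖u₁ i t ω - avg (fun j => x₁ j t ω)‖ ≤ disagreement η B₁ x₁ v₁ t ω)
    (hU₁ : ∀ x₁ ∈ X₁, ∀ x₂ ∈ X₂, U x₁ x₂ = 1 / (n₁ : ℝ) * ∑ i, f₁ i x₁ x₂)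
    (hU₂ : ∀ x₁ ∈ X₁, ∀ x₂ ∈ X₂, U x₁ x₂ = -(1 / (n₂ : ℝ) * ∑ j, f₂ j x₂ x₁))
    (hU : IsStronglyConvexConcave X₁ X₂ μ U) (hy : IsNash X₁ X₂ U y₁ y₂)
    (i : Fin n₁) (j : Fin n₂) (t : ℕ) : ∀ᵐ ω ∂P,
    μ / 2 * (‖x₁ i t ω - y₁‖ ^ 2 + ‖x₂ j t ω - y₂‖ ^ 2)
      ≤ 1 / (n₁ : ℝ) * ∑ i, g₁ i t ω (v₁ i t ω - y₁) + 1 / (n₂ : ℝ) * ∑ j, g₂ j t ω (v₂ j t ω - y₂)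
        + 4 * L * (disagreement η B₁ x₁ v₁ t ω + disagreement η B₂ x₂ v₂ t ω) := by
  filter_upwards [ae_all_iff.2 fun i => h₁.sampling.subgradient i t,
    ae_all_iff.2 fun j => h₂.sampling.subgradient j t] with ω hg₁ hg₂
  set c₁ := avg (fun j => x₁ j t ω) with hc₁
  set c₂ := avg (fun j => x₂ j t ω) with hc₂
  have hm₁ : c₁ ∈ X₁ := avg_mem h₁.n_pos h₁.convex fun j => h₁.mem j t ω
  have hm₂ : c₂ ∈ X₂ := avg_mem h₂.n_pos h₂.convex fun j => h₂.mem j t ω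
  -- Comparison at the averages `(c₁, c₂)`. In the sum of `e₁` and `e₂` the term `U c₁ c₂` cancels,
  -- and each disagreement appears with `L` from its own network and `2 L` from the other one, `3 L`
  -- in all.
  have e₁ := sub_le_avg_subgradient h₁.n_pos h₁.L_pos h₁.lipschitz hg₁
    (fun i => h₁.subset (h₁.v_mem i t ω)) (fun i => h₁.u_mem i t ω) (h₁.subset hm₁)
    (h₁.subset hy.1) hm₂ (fun i => h₁.norm_v_sub_avg_le i t ω) (fun i => hu₂ i t ω)
  have e₂ := sub_le_avg_subgradient h₂.n_pos h₂.L_pos h₂.lipschitz hg₂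
    (fun i => h₂.subset (h₂.v_mem i t ω)) (fun i => h₂.u_mem i t ω) (h₂.subset hm₂)
    (h₂.subset hy.2.1) hm₁ (fun i => h₂.norm_v_sub_avg_le i t ω) (fun i => hu₁ i t ω)
  have hgap := hy.gap_ge hU (h₁.mem i t ω) (h₂.mem j t ω)
  -- Passing from the averages to the estimates of the chosen agents in `U · y₂` and `U y₁ ·` costs
  -- one more `L` for each disagreement, which makes `4 L`.
  have d₁ := (abs_le.1 (IsLipschitzCost.avg h₁.n_pos h₁.lipschitz _ (h₁.subset (h₁.mem i t ω)) _
    (h₁.subset hm₁) y₂ hy.2.1 y₂ hy.2.1)).2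
  have d₂ := (abs_le.1 (IsLipschitzCost.avg h₁.n_pos h₁.lipschitz _ (h₁.subset hy.1) _
    (h₁.subset hy.1) _ (h₂.mem j t ω) _ hm₂)).1
  rw [← hU₁ _ hm₁ _ hm₂, ← hU₁ _ hy.1 _ hm₂] at e₁
  have k₁ := hU₂ _ hm₁ _ hm₂
  have k₂ := hU₂ _ hm₁ _ hy.2.1
  beta_reduce at d₁ d₂
  rw [sub_self, norm_zero, add_zero, ← hU₁ _ (h₁.mem i t ω) _ hy.2.1, ← hU₁ _ hm₁ _ hy.2.1] at d₁
  rw [sub_self, norm_zero, zero_add, ← hU₁ _ hy.1 _ (h₂.mem j t ω), ← hU₁ _ hy.1 _ hm₂] at d₂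
  have d₁' := mul_le_mul_of_nonneg_left (h₁.norm_sub_avg_le i t ω) h₁.L_pos.le
  have d₂' := mul_le_mul_of_nonneg_left (h₂.norm_sub_avg_le j t ω) h₁.L_pos.le
  linarith

theorem sum_step_mul_integral_sq_dist_le
    (h₁ : NetworkRun P X₁ O₁ X₂ ψ₁ R₁ α φ₁ f₁ L ν₁ η B₁ G₁ W₁ ℱ ξ₁ v₁ u₂ g₁ ghat₁ x₁)
    (h₂ : NetworkRun P X₂ O₂ X₁ ψ₂ R₂ α φ₂ f₂ L ν₂ η B₂ G₂ W₂ ℱ ξ₂ v₂ u₁ g₂ ghat₂ x₂)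
    (hu₂ : ∀ i t ω, ‖u₂ i t ω - avg (fun j => x₂ j t ω)‖ ≤ disagreement η B₂ x₂ v₂ t ω)
    (hu₁ : ∀ i t ω, ‖u₁ i t ω - avg (fun j => x₁ j t ω)‖ ≤ disagreement η B₁ x₁ v₁ t ω)
    (hU₁ : ∀ x₁ ∈ X₁, ∀ x₂ ∈ X₂, U x₁ x₂ = 1 / (n₁ : ℝ) * ∑ i, f₁ i x₁ x₂)
    (hU₂ : ∀ x₁ ∈ X₁, ∀ x₂ ∈ X₂, U x₁ x₂ = -(1 / (n₂ : ℝ) * ∑ j, f₂ j x₂ x₁))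
    (hU : IsStronglyConvexConcave X₁ X₂ μ U) (hy : IsNash X₁ X₂ U y₁ y₂)
    (i : Fin n₁) (j : Fin n₂) (T : ℕ) :
    μ / 2 * ∑ t ∈ Finset.range T,
        α t * ∫ ω, (‖x₁ i t ω - y₁‖ ^ 2 + ‖x₂ j t ω - y₂‖ ^ 2) ∂P
      ≤ M1part L η n₁ B₁ (Lam P x₁) (α 0) R₁ + M1part L η n₂ B₂ (Lam P x₂) (α 0) R₂
        + (M2part L ν₁ η n₁ B₁ + M2part L ν₂ η n₂ B₂) * ∑ t ∈ Finset.range T, α t ^ 2 := by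
  have hI₁ : ∀ t, Integrable (fun ω => 1 / (n₁ : ℝ) * ∑ i, g₁ i t ω (v₁ i t ω - y₁)) P := fun t =>
    (integrable_finsetSum _ fun i _ => (h₁.integral_g_eq i t y₁).2.1).const_mul _
  have hI₂ : ∀ t, Integrable (fun ω => 1 / (n₂ : ℝ) * ∑ i, g₂ i t ω (v₂ i t ω - y₂)) P := fun t =>
    (integrable_finsetSum _ fun i _ => (h₂.integral_g_eq i t y₂).2.1).const_mul _
  have hD₁ := h₁.integrable_disagreement
  have hD₂ := h₂.integrable_disagreement
  have key : ∀ t, μ / 2 * ∫ ω, (‖x₁ i t ω - y₁‖ ^ 2 + ‖x₂ j t ω - y₂‖ ^ 2) ∂P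
      ≤ ∫ ω, 1 / (n₁ : ℝ) * ∑ i, g₁ i t ω (v₁ i t ω - y₁) ∂P
        + ∫ ω, 1 / (n₂ : ℝ) * ∑ j, g₂ j t ω (v₂ j t ω - y₂) ∂P
        + 4 * L * (∫ ω, disagreement η B₁ x₁ v₁ t ω ∂P + ∫ ω, disagreement η B₂ x₂ v₂ t ω ∂P) := by
    intro t
    have hI : Integrable (fun ω => 1 / (n₁ : ℝ) * ∑ i, g₁ i t ω (v₁ i t ω - y₁)
        + 1 / (n₂ : ℝ) * ∑ j, g₂ j t ω (v₂ j t ω - y₂)) P := (hI₁ t).add (hI₂ t)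
    have hD : Integrable (fun ω => 4 * L *
        (disagreement η B₁ x₁ v₁ t ω + disagreement η B₂ x₂ v₂ t ω)) P :=
      ((hD₁ t).add (hD₂ t)).const_mul _
    rw [← integral_const_mul, ← integral_add (hI₁ t) (hI₂ t), ← integral_add (hD₁ t) (hD₂ t),
      ← integral_const_mul, ← integral_add hI hD]
    exact integral_mono_ae
      (((h₁.integrable_sq_dist i t y₁).add (h₂.integrable_sq_dist j t y₂)).const_mul _)
      (hI.add hD)
      (sq_dist_le_regret h₁ h₂ hu₂ hu₁ hU₁ hU₂ hU hy i j t)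
  have hsum : μ / 2 * ∑ t ∈ Finset.range T,
        α t * ∫ ω, (‖x₁ i t ω - y₁‖ ^ 2 + ‖x₂ j t ω - y₂‖ ^ 2) ∂P
      ≤ ∑ t ∈ Finset.range T, α t * ∫ ω, 1 / (n₁ : ℝ) * ∑ i, g₁ i t ω (v₁ i t ω - y₁) ∂P
        + ∑ t ∈ Finset.range T, α t * ∫ ω, 1 / (n₂ : ℝ) * ∑ j, g₂ j t ω (v₂ j t ω - y₂) ∂P
        + 4 * L * (∑ t ∈ Finset.range T, α t * ∫ ω, disagreement η B₁ x₁ v₁ t ω ∂P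
          + ∑ t ∈ Finset.range T, α t * ∫ ω, disagreement η B₂ x₂ v₂ t ω ∂P) := by
    rw [Finset.mul_sum, ← Finset.sum_add_distrib, ← Finset.sum_add_distrib, Finset.mul_sum,
      ← Finset.sum_add_distrib]
    refine Finset.sum_le_sum fun t _ => ?_
    have := mul_le_mul_of_nonneg_left (key t) (h₁.step_nonneg t)
    linarith
  have hQ : 0 ≤ ∑ t ∈ Finset.range T, α t ^ 2 := Finset.sum_nonneg fun _ _ => sq_nonneg _
  have r₁ := h₁.sum_step_mul_integral_le hy.1 T
  have r₂ := h₂.sum_step_mul_integral_le hy.2.1 T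
  have s₁ := mul_le_mul_of_nonneg_left (h₁.sum_step_mul_disagreement_le T)
    (mul_pos four_pos h₁.L_pos).le
  have s₂ := mul_le_mul_of_nonneg_left (h₂.sum_step_mul_disagreement_le T)
    (mul_pos four_pos h₁.L_pos).le
  have m₁ := regret_add_disagreement_le (η := η) (R := R₁) (Λ := Lam P x₁) (a := α 0) (n := n₁)
    (B := B₁) h₁.L_pos h₁.ν_pos hQ
  have m₂ := regret_add_disagreement_le (η := η) (R := R₂) (Λ := Lam P x₂) (a := α 0) (n := n₂)
    (B := B₂) h₂.L_pos h₂.ν_pos hQ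
  linarith

theorem integral_sqError_le
    (h₁ : NetworkRun P X₁ O₁ X₂ ψ₁ R₁ α φ₁ f₁ L ν₁ η B₁ G₁ W₁ ℱ ξ₁ v₁ u₂ g₁ ghat₁ x₁)
    (h₂ : NetworkRun P X₂ O₂ X₁ ψ₂ R₂ α φ₂ f₂ L ν₂ η B₂ G₂ W₂ ℱ ξ₂ v₂ u₁ g₂ ghat₂ x₂)
    (hμ : 0 < μ) {M : ℝ} (i : Fin n₁) (j : Fin n₂) {t : ℕ} (ht : 0 < ∑ s ∈ Finset.range t, α s)
    (hM : μ / 2 * ∑ s ∈ Finset.range t,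
        α s * ∫ ω, (‖x₁ i s ω - y₁‖ ^ 2 + ‖x₂ j s ω - y₂‖ ^ 2) ∂P ≤ M) :
    Integrable (sqError α (x₁ i) (x₂ j) y₁ y₂ t) P ∧
      ∫ ω, sqError α (x₁ i) (x₂ j) y₁ y₂ t ω ∂P ≤ 2 / μ * (M / ∑ s ∈ Finset.range t, α s) := by
  have : ProperSpace E₁ := FiniteDimensional.proper_real E₁
  have : ProperSpace E₂ := FiniteDimensional.proper_real E₂
  set A := ∑ s ∈ Finset.range t, α s
  have hpt : ∀ ω, sqError α (x₁ i) (x₂ j) y₁ y₂ t ω ≤ A⁻¹ * ∑ s ∈ Finset.range t,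
      α s * (‖x₁ i s ω - y₁‖ ^ 2 + ‖x₂ j s ω - y₂‖ ^ 2) := fun ω => by
    simp only [mul_add, Finset.sum_add_distrib]
    exact add_le_add (norm_timeAvg_sub_sq_le h₁.step_nonneg _ _ ht ω)
      (norm_timeAvg_sub_sq_le h₁.step_nonneg _ _ ht ω)
  have hd : ∀ s, Integrable (fun ω => α s * (‖x₁ i s ω - y₁‖ ^ 2 + ‖x₂ j s ω - y₂‖ ^ 2)) P :=
    fun s => ((h₁.integrable_sq_dist i s y₁).add (h₂.integrable_sq_dist j s y₂)).const_mul _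
  have hbi := (integrable_finsetSum (Finset.range t) fun s _ => hd s).const_mul A⁻¹
  have hint : Integrable (sqError α (x₁ i) (x₂ j) y₁ y₂ t) P := by
    refine hbi.mono' ?_ (ae_of_all _ fun ω => ?_)
    · have m₁ := measurable_timeAvg (α := α)
        (fun s => (h₁.measurable_state s i).mono (h₁.ℱ_le s) le_rfl) t
      have m₂ := measurable_timeAvg (α := α)
        (fun s => (h₂.measurable_state s j).mono (h₂.ℱ_le s) le_rfl) t
      exact (((m₁.sub_const y₁).norm.pow_const 2).add
        ((m₂.sub_const y₂).norm.pow_const 2)).aestronglyMeasurable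
    · rw [Real.norm_of_nonneg (by unfold sqError; positivity)]
      exact hpt ω
  refine ⟨hint, (integral_mono hint hbi hpt).trans ?_⟩
  rw [integral_const_mul, integral_finsetSum _ fun s _ => hd s]
  simp only [integral_const_mul]
  have h3 : ∑ s ∈ Finset.range t, α s * ∫ ω, (‖x₁ i s ω - y₁‖ ^ 2 + ‖x₂ j s ω - y₂‖ ^ 2) ∂P
      ≤ 2 / μ * M := by
    rw [div_mul_eq_mul_div, le_div_iff₀ hμ]
    linarith
  refine (mul_le_mul_of_nonneg_left h3 (inv_nonneg.2 ht.le)).trans_eq ?_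
  ring

end TwoNetworks

end DSMD

/-! ### The main theorem: unique equilibrium, rate and mean square convergence. -/

theorem corollary2
    {Ω : Type*} [MeasurableSpace Ω] (P : Measure Ω) [IsProbabilityMeasure P]
    -- the strategy spaces, with arbitrary norms
    {E₁ : Type*} [NormedAddCommGroup E₁] [NormedSpace ℝ E₁] [FiniteDimensional ℝ E₁]
    [MeasurableSpace E₁] [BorelSpace E₁]
    {E₂ : Type*} [NormedAddCommGroup E₂] [NormedSpace ℝ E₂] [FiniteDimensional ℝ E₂]
    [MeasurableSpace E₂] [BorelSpace E₂]
    -- the strategy sets and open convex neighbourhoods on which the costs are defined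
    (X₁ O₁ : Set E₁) (X₂ O₂ : Set E₂)
    (hX₁ : X₁.Nonempty ∧ IsCompact X₁ ∧ Convex ℝ X₁)
    (hX₂ : X₂.Nonempty ∧ IsCompact X₂ ∧ Convex ℝ X₂)
    (hO₁ : IsOpen O₁ ∧ Convex ℝ O₁ ∧ X₁ ⊆ O₁) (hO₂ : IsOpen O₂ ∧ Convex ℝ O₂ ∧ X₂ ⊆ O₂)
    -- the networks
    {n₁ n₂ : ℕ} (hn₁ : 0 < n₁) (hn₂ : 0 < n₂) (η : ℝ) (hη : 0 < η ∧ η < 1) (B₁ B₂ : ℕ)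
    (G₁ : ℕ → Digraph (Fin n₁)) (W₁ : ℕ → Matrix (Fin n₁) (Fin n₁) ℝ)
    (G₂ : ℕ → Digraph (Fin n₂)) (W₂ : ℕ → Matrix (Fin n₂) (Fin n₂) ℝ)
    (G₁₂ : ℕ → Digraph (Fin n₁ ⊕ Fin n₂))
    (W₁₂ : ℕ → Matrix (Fin n₁ ⊕ Fin n₂) (Fin n₁ ⊕ Fin n₂) ℝ)
    (hW₁ : DSMD.IsMixing G₁ W₁ η B₁) (hW₂ : DSMD.IsMixing G₂ W₂ η B₂)
    (hW₁₂ : DSMD.IsCrossMixing G₁₂ W₁₂)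
    -- the random vector and the sampled and expected costs of the agents
    {d : ℕ} (ξ : Ω → (Fin d → ℝ))
    (φ₁ : Fin n₁ → E₁ → E₂ → (Fin d → ℝ) → ℝ) (φ₂ : Fin n₂ → E₁ → E₂ → (Fin d → ℝ) → ℝ)
    (f₁ : Fin n₁ → E₁ → E₂ → ℝ) (f₂ : Fin n₂ → E₁ → E₂ → ℝ)
    (hf₁ : f₁ = fun i => DSMD.expCost P ξ (φ₁ i)) (hf₂ : f₂ = fun j => DSMD.expCost P ξ (φ₂ j))
    (hφ₁ : ∀ i, ∀ x₁ ∈ O₁, ∀ x₂ ∈ X₂, Integrable (fun ω => φ₁ i x₁ x₂ (ξ ω)) P)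
    (hφ₂ : ∀ j, ∀ x₁ ∈ X₁, ∀ x₂ ∈ O₂, Integrable (fun ω => φ₂ j x₁ x₂ (ξ ω)) P)
    (hcc₁ : ∀ i, DSMD.IsConvexConcave O₁ X₂ (f₁ i))
    (hcc₂ : ∀ j, DSMD.IsConvexConcave O₂ X₁ (fun x₂ x₁ => f₂ j x₁ x₂))
    -- the cost function of the game
    (U : E₁ → E₂ → ℝ)
    (hU₁ : ∀ x₁ ∈ X₁, ∀ x₂ ∈ X₂, U x₁ x₂ = (1 / (n₁ : ℝ)) * ∑ i, f₁ i x₁ x₂)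
    (hU₂ : ∀ x₁ ∈ X₁, ∀ x₂ ∈ X₂, U x₁ x₂ = -((1 / (n₂ : ℝ)) * ∑ j, f₂ j x₁ x₂))
    (μ : ℝ) (hμ : 0 < μ) (hU : DSMD.IsStronglyConvexConcave X₁ X₂ μ U)
    -- the regularizers
    (ψ₁ : E₁ → ℝ) (ψ₂ : E₂ → ℝ)
    (hψ₁ : DSMD.IsRegularizer X₁ ψ₁) (hψ₂ : DSMD.IsRegularizer X₂ ψ₂)
    (R₁ R₂ : ℝ) (hR₁ : DSMD.IsBregmanDiam X₁ ψ₁ R₁) (hR₂ : DSMD.IsBregmanDiam X₂ ψ₂ R₂)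
    -- the algorithm: step sizes, samples, averages over the neighbours, sampled subgradients
    (α : ℕ → ℝ) (hα₀ : ∀ t, 0 ≤ α t) (hα : Antitone α)
    (ξ₁ : Fin n₁ → ℕ → Ω → (Fin d → ℝ)) (ξ₂ : Fin n₂ → ℕ → Ω → (Fin d → ℝ))
    (hξ : DSMD.IsIIDSample P ξ ξ₁ ξ₂)
    (x₁ v₁ : Fin n₁ → ℕ → Ω → E₁) (u₂ : Fin n₁ → ℕ → Ω → E₂)
    (x₂ v₂ : Fin n₂ → ℕ → Ω → E₂) (u₁ : Fin n₂ → ℕ → Ω → E₁)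
    (hv₁ : v₁ = fun i t => DSMD.mix (W₁ t i) x₁ t)
    (hv₂ : v₂ = fun i t => DSMD.mix (W₂ t i) x₂ t)
    (hu₂ : u₂ = fun i t => DSMD.mix (fun j => W₁₂ t (Sum.inl i) (Sum.inr j)) x₂ t)
    (hu₁ : u₁ = fun i t => DSMD.mix (fun j => W₁₂ t (Sum.inr i) (Sum.inl j)) x₁ t)
    (g₁ ghat₁ : Fin n₁ → ℕ → Ω → StrongDual ℝ E₁) (g₂ ghat₂ : Fin n₂ → ℕ → Ω → StrongDual ℝ E₂)
    (hrun₁ : DSMD.IsRun X₁ O₁ ψ₁ α φ₁ (DSMD.history x₁ x₂ ξ₁ ξ₂) ξ₁ v₁ u₂ ghat₁ x₁)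
    (hrun₂ : DSMD.IsRun X₂ O₂ ψ₂ α (fun j x₂ x₁ z => φ₂ j x₁ x₂ z)
      (DSMD.history x₁ x₂ ξ₁ ξ₂) ξ₂ v₂ u₁ ghat₂ x₂)
    -- first assumption: Lipschitz costs
    (L : ℝ) (hL : 0 < L)
    (hA1₁ : ∀ i, DSMD.IsLipschitzCost O₁ X₂ L (f₁ i))
    (hA1₂ : ∀ j, DSMD.IsLipschitzCost O₂ X₁ L (fun x₂ x₁ => f₂ j x₁ x₂))
    -- second assumption: unbiased sampled subgradients with bounded variance
    (ν₁ ν₂ : ℝ) (hν₁ : 0 < ν₁) (hν₂ : 0 < ν₂)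
    (hA2₁ : DSMD.UnbiasedSampling P O₁ f₁ ν₁ (DSMD.history x₁ x₂ ξ₁ ξ₂) v₁ u₂ g₁ ghat₁)
    (hA2₂ : DSMD.UnbiasedSampling P O₂ (fun j x₂ x₁ => f₂ j x₁ x₂) ν₂
      (DSMD.history x₁ x₂ ξ₁ ξ₂) v₂ u₁ g₂ ghat₂)
    -- third assumption: Bregman divergences
    (hA3₁ : DSMD.BregmanAssumption X₁ ψ₁) (hA3₂ : DSMD.BregmanAssumption X₂ ψ₂)
    -- the constants of the bound
    (M₁ M₂ : ℝ)
    (hM₁ : M₁ = DSMD.M1part L η n₁ B₁ (DSMD.Lam P x₁) (α 0) R₁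
      + DSMD.M1part L η n₂ B₂ (DSMD.Lam P x₂) (α 0) R₂)
    (hM₂ : M₂ = DSMD.M2part L ν₁ η n₁ B₁ + DSMD.M2part L ν₂ η n₂ B₂) :
    (∃! y : E₁ × E₂, DSMD.IsNash X₁ X₂ U y.1 y.2) ∧
    ∀ y₁ y₂, DSMD.IsNash X₁ X₂ U y₁ y₂ → ∀ (i : Fin n₁) (j : Fin n₂),
      (∀ t : ℕ, 0 < ∑ s ∈ Finset.range t, α s →
        Integrable (DSMD.sqError α (x₁ i) (x₂ j) y₁ y₂ t) P ∧
        ∫ ω, DSMD.sqError α (x₁ i) (x₂ j) y₁ y₂ t ω ∂P ≤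
          2 / μ * ((M₁ + M₂ * ∑ s ∈ Finset.range t, α s ^ 2) / ∑ s ∈ Finset.range t, α s)) ∧
      (Tendsto (fun t => ∑ s ∈ Finset.range t, α s) atTop atTop → Summable (fun t => α t ^ 2) →
        Tendsto (fun t => ∫ ω, DSMD.sqError α (x₁ i) (x₂ j) y₁ y₂ t ω ∂P) atTop (𝓝 0)) := by
  have hle := DSMD.history_le hrun₁.init_measurable hrun₂.init_measurable hξ.measurable₁
    hξ.measurable₂
  have hmem₁ : ∀ i t ω, x₁ i t ω ∈ X₁ := fun i t ω => by
    cases t with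
    | zero => exact hrun₁.init_mem i ω
    | succ t => exact (hrun₁.update i t ω).1
  have hmem₂ : ∀ i t ω, x₂ i t ω ∈ X₂ := fun i t ω => by
    cases t with
    | zero => exact hrun₂.init_mem i ω
    | succ t => exact (hrun₂.update i t ω).1
  have h₁ : DSMD.NetworkRun P X₁ O₁ X₂ ψ₁ R₁ α φ₁ f₁ L ν₁ η B₁ G₁ W₁
      (DSMD.history x₁ x₂ ξ₁ ξ₂) ξ₁ v₁ u₂ g₁ ghat₁ x₁ :=
    { n_pos := hn₁
      η_mem := hη
      L_pos := hL
      ν_pos := hν₁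
      step_nonneg := hα₀
      step_antitone := hα
      nonempty := hX₁.1
      compact := hX₁.2.1
      convex := hX₁.2.2
      isOpen := hO₁.1
      subset := hO₁.2.2
      regularizer := hψ₁
      diam := hR₁
      bregman_convex := hA3₁.convex_right
      lipschitz := hA1₁
      mixing := hW₁
      v_eq := hv₁
      u_mem := fun i t ω => by
        rw [hu₂]
        exact DSMD.mix_mem hX₂.2.2 (fun j => hW₁₂.nonneg _ _ _) (hW₁₂.row_sum₁ t i)
          fun j => hmem₂ j t ω
      ℱ_mono := DSMD.history_mono
      ℱ_le := hle
      init_measurable := DSMD.measurable_history_left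
      run := hrun₁
      sampling := hA2₁ }
  have h₂ : DSMD.NetworkRun P X₂ O₂ X₁ ψ₂ R₂ α (fun j x₂ x₁ z => φ₂ j x₁ x₂ z)
      (fun j x₂ x₁ => f₂ j x₁ x₂) L ν₂ η B₂ G₂ W₂
      (DSMD.history x₁ x₂ ξ₁ ξ₂) ξ₂ v₂ u₁ g₂ ghat₂ x₂ :=
    { n_pos := hn₂
      η_mem := hη
      L_pos := hL
      ν_pos := hν₂
      step_nonneg := hα₀
      step_antitone := hα
      nonempty := hX₂.1
      compact := hX₂.2.1
      convex := hX₂.2.2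
      isOpen := hO₂.1
      subset := hO₂.2.2
      regularizer := hψ₂
      diam := hR₂
      bregman_convex := hA3₂.convex_right
      lipschitz := hA1₂
      mixing := hW₂
      v_eq := hv₂
      u_mem := fun i t ω => by
        rw [hu₁]
        exact DSMD.mix_mem hX₁.2.2 (fun j => hW₁₂.nonneg _ _ _) (hW₁₂.row_sum₂ t i)
          fun j => hmem₁ j t ω
      ℱ_mono := DSMD.history_mono
      ℱ_le := hle
      init_measurable := DSMD.measurable_history_right
      run := hrun₂
      sampling := hA2₂ }
  -- The weights between the networks need no mixing property: a convex combination of estimates is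
  -- as close to their average as the estimates are.
  have hd₂ : ∀ i t ω, ‖u₂ i t ω - DSMD.avg (fun j => x₂ j t ω)‖
      ≤ DSMD.disagreement η B₂ x₂ v₂ t ω := fun i t ω => by
    rw [hu₂]
    exact DSMD.norm_mix_sub_le (fun j => hW₁₂.nonneg _ _ _) (hW₁₂.row_sum₁ t i)
      fun j => h₂.norm_sub_avg_le j t ω
  have hd₁ : ∀ i t ω, ‖u₁ i t ω - DSMD.avg (fun j => x₁ j t ω)‖
      ≤ DSMD.disagreement η B₁ x₁ v₁ t ω := fun i t ω => by
    rw [hu₁]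
    exact DSMD.norm_mix_sub_le (fun j => hW₁₂.nonneg _ _ _) (hW₁₂.row_sum₂ t i)
      fun j => h₁.norm_sub_avg_le j t ω
  -- On `X₁ × X₂` the game cost is an average of the costs of network 1 and inherits their Lipschitz
  -- constant.
  have hUL : DSMD.IsLipschitzCost X₁ X₂ L U := by
    intro x hx x' hx' y hy y' hy'
    rw [hU₁ x hx y hy, hU₁ x' hx' y' hy']
    exact DSMD.IsLipschitzCost.avg hn₁ hA1₁ x (hO₁.2.2 hx) x' (hO₁.2.2 hx') y hy y' hy'
  refine ⟨?_, fun y₁ y₂ hy i j => ?_⟩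
  · obtain ⟨y₁, y₂, hy⟩ := DSMD.exists_isNash hX₁ hX₂ hL hUL hμ hU
    refine ⟨(y₁, y₂), hy, fun z hz => ?_⟩
    obtain ⟨e₁, e₂⟩ := hy.unique hμ hU hz
    exact Prod.ext e₁ e₂
  have hbound : ∀ t : ℕ, 0 < ∑ s ∈ Finset.range t, α s →
      Integrable (DSMD.sqError α (x₁ i) (x₂ j) y₁ y₂ t) P ∧
      ∫ ω, DSMD.sqError α (x₁ i) (x₂ j) y₁ y₂ t ω ∂P ≤
        2 / μ * ((M₁ + M₂ * ∑ s ∈ Finset.range t, α s ^ 2) / ∑ s ∈ Finset.range t, α s) := by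
    intro t ht
    refine DSMD.integral_sqError_le h₁ h₂ hμ i j ht ?_
    rw [hM₁, hM₂]
    exact DSMD.sum_step_mul_integral_sq_dist_le h₁ h₂ hd₂ hd₁ hU₁ hU₂ hU hy i j t
  refine ⟨hbound, fun hA hQ => ?_⟩
  -- The sign of `M₂` is needed to replace the partial sums of `α s ^ 2` by the full series, which
  -- makes the numerator of the bound constant.
  have hM₂0 : 0 ≤ M₂ := by
    rw [hM₂]
    exact add_nonneg (DSMD.M2part_nonneg hL hν₁ hη hn₁ hW₁.one_le_window)
      (DSMD.M2part_nonneg hL hν₂ hη hn₂ hW₂.one_le_window)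
  have hlim : Tendsto (fun t => 2 / μ * ((M₁ + M₂ * ∑' s, α s ^ 2) / ∑ s ∈ Finset.range t, α s))
      atTop (𝓝 0) := by
    simpa using (hA.const_div_atTop (M₁ + M₂ * ∑' s, α s ^ 2)).const_mul (2 / μ)
  refine squeeze_zero' (Eventually.of_forall fun t => integral_nonneg fun ω => ?_) ?_ hlim
  · exact add_nonneg (sq_nonneg _) (sq_nonneg _)
  -- The bound is available only once the step sizes have a positive partial sum, which holds
  -- eventually by divergence.
  · filter_upwards [hA.eventually_gt_atTop 0] with t ht
    refine (hbound t ht).2.trans ?_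
    gcongr
    exact hQ.sum_le_tsum _ fun s _ => sq_nonneg _
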